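/- Let $q\ge 9$ be an odd prime power and let $V$ be a vector space over $\mathbb F_q$ of finite dimension $d\ge 5$ with a nondegenerate symmetric bilinear form $f$. Types. For a nondegenerate symmetric form of dimension $m$, let $\Delta$ be the determinant of a Gram matrix and $e=\lfloor m/2\rfloor$. If $m$ is even or $q\equiv 1 \pmod 4$, the form is called positive if $(-1)^e\Delta$ is a square in $\mathbb F_q$; if $m$ is odd and $q\equiv 3\pmod 4$, it is called positive if $(-1)^e\Delta$ is a nonsquare. Otherwise it is called negative. (In even dimension, positive means of maximal Witt index.) A subspace $u\le V$ is called nondegenerate, positive or negative if $f|_u$ is. Assume that $f$ itself is positive. Geometry. A pregeometry over a type set $I$ is a set with a symmetric reflexive incidence relation and a surjective type function to $I$ such that incident elements of the same type are equal. A flag is a set of pairwise incident elements; a chamber is a flag in which every type occurs; the pregeometry is a geometry if every flag lies in a chamber. A hall is a set $W$ of elements in which every type occurs and such that every subset of $W$ with pairwise distinct types is a flag. A geometry is simply connected if it is nonempty, any two elements are joined by a path of consecutively incident elements, and every closed path can be transformed into a constant path by inserting and deleting cycles of length $1$, $2$ or $3$. Let $\mathcal G$ be the pregeometry over $\{1,\dots,d-1\}$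 of all nonzero proper nondegenerate subspaces of $V$, with symmetrized containment as incidence and dimension as type. Let $W=\{p,p',l,\pi,U\}\cup S$ be a hall of $\mathcal G$, where $p$ is a positive and $p'$ a negative $1$-dimensional subspace, $l$ is a negative $2$-dimensional subspace, $\pi$ is a $3$-dimensional subspace (positive or negative), $U$ is a positive $4$-dimensional subspace, and every member of $S$ has dimension at least $3$. Let $\mathcal G^W$ be the pregeometry induced by $\mathcal G$ on the set of all $g(w)$ with $w\in W$ and $g\in \mathrm{SO}(V,f)$. Then $\mathcal G^W$ is a simply connected geometry. -/

import Mathlib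

universe u v

/-! ### Pregeometries and geometries -/

/-- A pregeometry over the type set `I` with set of elements `X`. -/
structure Pregeometry (X : Type u) (I : Type v) where
  inc : X → X → Prop
  typ : X → I
  inc_refl : ∀ x, inc x x
  inc_symm : ∀ x y, inc x y → inc y x
  typ_surjective : Function.Surjective typ
  eq_of_inc_of_typ_eq : ∀ x y, inc x y → typ x = typ y → x = y

namespace Pregeometry

variable {X : Type u} {I : Type v} (G : Pregeometry X I)

/-- A flag is a set of pairwise incident elements. -/
def IsFlag (A : Set X) : Prop := ∀ x ∈ A, ∀ y ∈ A, G.inc x y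

/-- A chamber is a flag whose type is the whole type set. -/
def IsChamber (A : Set X) : Prop := G.IsFlag A ∧ G.typ '' A = Set.univ

/-- A geometry is a pregeometry in which every flag is contained in a chamber. -/
def IsGeometry : Prop := ∀ A, G.IsFlag A → ∃ C, G.IsChamber C ∧ A ⊆ C

/-- A lounge is a set of elements all of whose subsets with pairwise distinct types are flags. -/
def IsLounge (W : Set X) : Prop := ∀ A, A ⊆ W → Set.InjOn G.typ A → G.IsFlag A

/-- A hall is a lounge that has elements of every type. -/
def IsHall (W : Set X) : Prop := G.IsLounge W ∧ G.typ '' W = Set.univ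

/-- The pregeometry induced on a set `Y` of elements, over the set of types occurring in `Y`. -/
def restrict (Y : Set X) : Pregeometry Y (G.typ '' Y) where
  inc x y := G.inc x y
  typ x := ⟨G.typ x, x, x.2, rfl⟩
  inc_refl x := G.inc_refl x
  inc_symm x y h := G.inc_symm x y h
  typ_surjective := by
    rintro ⟨_, x, hx, rfl⟩
    exact ⟨⟨x, hx⟩, rfl⟩
  eq_of_inc_of_typ_eq x y h ht :=
    Subtype.ext (G.eq_of_inc_of_typ_eq x y h (congrArg Subtype.val ht))

/-- The incidence graph is nonempty and any two elements are joined by a path in it. -/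
def IsConnected : Prop := Nonempty X ∧ ∀ x y, Relation.ReflTransGen G.inc x y

/-- `p = (x₀, …, x_k)` is a cycle based at `x`: consecutive elements are incident and
`x₀ = x_k = x`. -/
def IsCycleAt (x : X) (p : List X) : Prop :=
  p.IsChain G.inc ∧ p.head? = some x ∧ p.getLast? = some x

/-- Inserting a repetition, a return or a triangle into a path, i.e. replacing an occurrence of
`x` in the path by a cycle of length one, two or three based at `x`. -/
inductive ElementaryInsertion : List X → List X → Prop
  | repetition (l₁ l₂ : List X) (x : X) :
      ElementaryInsertion (l₁ ++ [x] ++ l₂) (l₁ ++ [x, x] ++ l₂)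
  | return (l₁ l₂ : List X) (x y : X) (hxy : G.inc x y) :
      ElementaryInsertion (l₁ ++ [x] ++ l₂) (l₁ ++ [x, y, x] ++ l₂)
  | triangle (l₁ l₂ : List X) (x y z : X) (hxy : G.inc x y) (hyz : G.inc y z) (hzx : G.inc z x) :
      ElementaryInsertion (l₁ ++ [x] ++ l₂) (l₁ ++ [x, y, z, x] ++ l₂)

/-- Homotopy of paths: the equivalence relation generated by the elementary insertions. -/
def Homotopic : List X → List X → Prop := Relation.EqvGen G.ElementaryInsertion

/-- A simply connected geometry: a connected geometry all of whose fundamental groups are trivial,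
that is, in which every cycle is homotopic to the trivial cycle at its base element. -/
def IsSimplyConnected : Prop :=
  G.IsGeometry ∧ G.IsConnected ∧ ∀ x p, G.IsCycleAt x p → G.Homotopic p [x]

end Pregeometry

/-! ### Symmetric bilinear forms over finite fields of odd order -/

/-- The determinant of a Gram matrix of `B`, normalized by the sign `(-1)^e` where
`e = ⌊dim V / 2⌋`. A change of basis multiplies it by a nonzero square. -/
noncomputable def signedDiscr {F : Type u} {V : Type v} [Field F] [AddCommGroup V] [Module F V]
    [FiniteDimensional F V] (B : LinearMap.BilinForm F V) : F :=
  (-1) ^ (Module.finrank F V / 2) *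
    (LinearMap.BilinForm.toMatrix (Module.finBasis F V) B).det

/-- Positive (hyperbolic, plus) type of a nondegenerate symmetric form over a field of odd order
`q`. With `δ` the signed discriminant:
* in even dimension the form is positive iff `δ` is a square (equivalently, it has maximal Witt
  index);
* in odd dimension and `q ≡ 1 mod 4` the form is positive iff `δ` is a square; as `-1` is then a
  square, this is the rule that one-spaces with square values are positive, others negative, and
  that signs multiply in orthogonal sums;
* in odd dimension and `q ≡ 3 mod 4` the form is positive iff `δ` is a nonsquare. -/
def IsPositiveForm {F : Type u} {V : Type v} [Field F] [Fintype F] [AddCommGroup V] [Module F V]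
    [FiniteDimensional F V] (B : LinearMap.BilinForm F V) : Prop :=
  B.Nondegenerate ∧
    (IsSquare (signedDiscr B) ↔ (Even (Module.finrank F V) ∨ Fintype.card F % 4 = 1))

/-- Negative (elliptic, minus) type: nondegenerate and not positive. -/
def IsNegativeForm {F : Type u} {V : Type v} [Field F] [Fintype F] [AddCommGroup V] [Module F V]
    [FiniteDimensional F V] (B : LinearMap.BilinForm F V) : Prop :=
  B.Nondegenerate ∧ ¬ IsPositiveForm B

/-- The special orthogonal group of `B`: linear isometries of determinant one. -/
def specialOrthogonal {F : Type u} {V : Type v} [Field F] [AddCommGroup V] [Module F V]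
    (B : LinearMap.BilinForm F V) : Subgroup (V ≃ₗ[F] V) where
  carrier := {g | (∀ x y, B (g x) (g y) = B x y) ∧ LinearEquiv.det g = 1}
  mul_mem' := by
    rintro g h ⟨hg, hg1⟩ ⟨hh, hh1⟩
    exact ⟨fun x y => by simp [LinearEquiv.mul_apply, hg, hh], by rw [map_mul, hg1, hh1, mul_one]⟩
  one_mem' := ⟨fun x y => rfl, map_one _⟩
  inv_mem' := by
    rintro g ⟨hg, hg1⟩
    refine ⟨fun x y => ?_, by rw [map_inv, hg1, inv_one]⟩
    rw [← hg]
    change B ((g * g⁻¹) x) ((g * g⁻¹) y) = B x y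
    rw [mul_inv_cancel]
    rfl

theorem two_ne_zero_of_odd_card {F : Type u} [Field F] [Fintype F]
    (h : Odd (Fintype.card F)) : (2 : F) ≠ 0 := by
  intro h2
  have hc : ringChar F = 2 := by
    have hd : ringChar F ∣ 2 := (ringChar.spec F 2).1 (by exact_mod_cast h2)
    rcases (Nat.dvd_prime Nat.prime_two).1 hd with h1 | h1
    · exact absurd h1 (CharP.ringChar_ne_one)
    · exact h1
  have := FiniteField.even_card_of_char_two hc
  rw [Nat.odd_iff] at h
  omega

/-! ### The geometry of nondegenerate subspaces -/

/-- The proper nonzero subspaces of `V` on which `B` is nondegenerate. -/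
structure NondegSubspace {F : Type u} {V : Type v} [Field F] [AddCommGroup V] [Module F V]
    (B : LinearMap.BilinForm F V) where
  carrier : Submodule F V
  ne_bot : carrier ≠ ⊥
  ne_top : carrier ≠ ⊤
  nondegenerate : (B.restrict carrier).Nondegenerate

/-- Nondegenerate subspaces exist in every dimension `0 < i < dim V`. -/
theorem exists_nondegSubspace {F : Type u} {V : Type v} [Field F] [AddCommGroup V] [Module F V]
    [FiniteDimensional F V] (B : LinearMap.BilinForm F V) (hs : B.IsSymm) (hn : B.Nondegenerate)
    (h2 : (2 : F) ≠ 0) (i : ℕ) (hi : 0 < i) (hi' : i < Module.finrank F V) :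
    ∃ U : NondegSubspace B, Module.finrank F U.carrier = i := by
  let _ : Invertible (2 : F) := invertibleOfNonzero h2
  obtain ⟨v, hv⟩ := LinearMap.BilinForm.exists_orthogonal_basis
    (LinearMap.BilinForm.isSymm_iff.1 hs)
  have hne : ∀ j, B (v j) (v j) ≠ 0 :=
    fun j => LinearMap.IsOrthoᵢ.not_isOrtho_basis_self_of_separatingLeft hv hn.1 j
  let w : Fin i → V := fun j => v (Fin.castLE hi'.le j)
  have hw : LinearIndependent F w :=
    v.linearIndependent.comp _ (Fin.castLE_injective hi'.le)
  let b := Module.Basis.span hw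
  have hb : ∀ j, ((b j : Submodule.span F (Set.range w)) : V) = w j :=
    fun j => congrArg Subtype.val (Module.Basis.span_apply hw j)
  have hr : Module.finrank F (Submodule.span F (Set.range w)) = i := by
    rw [finrank_span_eq_card hw, Fintype.card_fin]
  refine ⟨⟨Submodule.span F (Set.range w), ?_, ?_, ?_⟩, hr⟩
  · intro h
    rw [h, finrank_bot] at hr
    omega
  · intro h
    rw [h, finrank_top] at hr
    omega
  · refine LinearMap.IsOrthoᵢ.nondegenerate_of_not_isOrtho_basis_self b ?_ ?_
    · intro j k hjk
      change B (b j : V) (b k : V) = 0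
      rw [hb, hb]
      exact hv (fun h => hjk (Fin.castLE_injective hi'.le h))
    · intro j
      change B (b j : V) (b j : V) ≠ 0
      rw [hb]
      exact hne _

/-- The pregeometry of all proper nonzero nondegenerate subspaces of `V`, with symmetrized
containment as incidence and dimension as type. -/
noncomputable def orthPregeometry {F : Type u} {V : Type v} [Field F] [AddCommGroup V] [Module F V]
    [FiniteDimensional F V] (B : LinearMap.BilinForm F V) (hs : B.IsSymm) (hn : B.Nondegenerate)
    (h2 : (2 : F) ≠ 0) :
    Pregeometry (NondegSubspace B) {i : ℕ // 0 < i ∧ i < Module.finrank F V} where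
  inc x y := x.carrier ≤ y.carrier ∨ y.carrier ≤ x.carrier
  typ x := ⟨Module.finrank F x.carrier,
    Nat.pos_of_ne_zero (fun h => x.ne_bot (Submodule.finrank_eq_zero.1 h)),
    Submodule.finrank_lt x.ne_top⟩
  inc_refl x := Or.inl le_rfl
  inc_symm x y h := h.symm
  typ_surjective := by
    rintro ⟨i, hi, hi'⟩
    obtain ⟨U, hU⟩ := exists_nondegSubspace B hs hn h2 i hi hi'
    exact ⟨U, Subtype.ext hU⟩
  eq_of_inc_of_typ_eq x y h ht := by
    have ht' : Module.finrank F x.carrier = Module.finrank F y.carrier := congrArg Subtype.val ht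
    have hc : x.carrier = y.carrier := by
      rcases h with h | h
      · exact Submodule.eq_of_le_of_finrank_eq h ht'
      · exact (Submodule.eq_of_le_of_finrank_eq h ht'.symm).symm
    cases x
    cases y
    simp only at hc
    subst hc
    rfl

namespace NondegSubspace

/-- The dimension of a nondegenerate subspace. -/
noncomputable def dim {F : Type u} {V : Type v} [Field F] [AddCommGroup V] [Module F V]
    {B : LinearMap.BilinForm F V} (x : NondegSubspace B) : ℕ := Module.finrank F x.carrier

/-- The restriction of the form to the subspace is positive. -/
def IsPositive {F : Type u} {V : Type v} [Field F] [Fintype F] [AddCommGroup V] [Module F V]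
    [FiniteDimensional F V] {B : LinearMap.BilinForm F V} (x : NondegSubspace B) : Prop :=
  IsPositiveForm (B.restrict x.carrier)

/-- The restriction of the form to the subspace is negative. -/
def IsNegative {F : Type u} {V : Type v} [Field F] [Fintype F] [AddCommGroup V] [Module F V]
    [FiniteDimensional F V] {B : LinearMap.BilinForm F V} (x : NondegSubspace B) : Prop :=
  IsNegativeForm (B.restrict x.carrier)

/-- All images of the members of `W` under elements of the special orthogonal group. -/
def orbitSet {F : Type u} {V : Type v} [Field F] [AddCommGroup V] [Module F V]
    {B : LinearMap.BilinForm F V} (W : Set (NondegSubspace B)) : Set (NondegSubspace B) :=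
  {x | ∃ g ∈ specialOrthogonal B, ∃ w ∈ W, x.carrier = w.carrier.map (g : V →ₗ[F] V)}

end NondegSubspace

/-! By Witt's theorem the special orthogonal group is transitive on nondegenerate subspaces of given
dimension and sign. So the induced geometry contains all nonsingular points, all elliptic (negative)
lines and all positive solids (4-spaces), and none of its members is a hyperbolic line.
`EllipticModel` records exactly what is needed of this. Flags extend to chambers because both signs
occur strictly between nested nondegenerate subspaces (`exists_nondegenerate_between`).

Homotopy classes of paths form a local system, and a global section through each fibre element makes
every cycle null (`homotopic_of_exists_section`). To construct sections, join two nonsingular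
vectors when they span an elliptic line. Each elliptic line contains a neighbour of each nonsingular
vector (`exists_elliptic_smul_add`), so any two vectors have a common neighbour. The section at `a`
is obtained by transport from a base vector `o` over a common neighbour. It is well defined once
quadrangles are null (`quadNull`), and then extends to all members, since nonsingular vectors of one
member are joined inside that member.

Quadrangles `o, c, a, c'` are filled by positive solids. If `o, a` span a hyperbolic line, the
components `z, z'` of `c, c'` orthogonal to it are nonsingular; when they too span a hyperbolic
line, all lies in one positive solid, and otherwise intermediate common neighbours are inserted
(`quadNull_of_hyperbolic`). A triangle lies in a line or a positive solid unless it spans a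
degenerate 3-space; in that case it is cut up by a further vector orthogonal to two of its vertices
(`triNull`). An elliptic diagonal splits a quadrangle into two triangles, and if both diagonals are
degenerate, one vertex is first slid along a side. -/

/-! ### Squares in finite fields of odd order -/

section FiniteFields

variable {F : Type u} [Field F]

theorem ringChar_ne_two_of_two_ne_zero (h2 : (2 : F) ≠ 0) : ringChar F ≠ 2 := fun h => by
  have := ringChar.spec F 2
  rw [h] at this
  exact h2 (by exact_mod_cast this.2 dvd_rfl)

theorem isSquare_mul_iff_of_isSquare {a b : F} (ha0 : a ≠ 0) (ha : IsSquare a) :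
    IsSquare (a * b) ↔ IsSquare b := by
  refine ⟨fun h => ?_, fun h => ha.mul h⟩
  have : b = a * b / a := by field_simp
  rw [this]
  exact h.div ha

theorem isSquare_sq_mul_iff {k b : F} (hk : k ≠ 0) : IsSquare (k ^ 2 * b) ↔ IsSquare b :=
  isSquare_mul_iff_of_isSquare (pow_ne_zero 2 hk) (IsSquare.sq k)

variable [Fintype F]

theorem isSquare_mul_of_not_isSquare (h2 : (2 : F) ≠ 0) {a b : F} (ha : ¬ IsSquare a)
    (hb : ¬ IsSquare b) : IsSquare (a * b) := by
  classical
  have hF := ringChar_ne_two_of_two_ne_zero h2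
  have ha0 : a ≠ 0 := by rintro rfl; exact ha (IsSquare.zero)
  have hb0 : b ≠ 0 := by rintro rfl; exact hb (IsSquare.zero)
  have h1 := (quadraticChar_neg_one_iff_not_isSquare (F := F)).2 ha
  have h3 := (quadraticChar_neg_one_iff_not_isSquare (F := F)).2 hb
  rw [← quadraticChar_one_iff_isSquare (mul_ne_zero ha0 hb0), map_mul, h1, h3]
  norm_num

theorem isSquare_mul_iff_of_not_isSquare (h2 : (2 : F) ≠ 0) {a b : F} (hb0 : b ≠ 0)
    (ha : ¬ IsSquare a) : IsSquare (a * b) ↔ ¬ IsSquare b := by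
  refine ⟨fun h hb => ha ?_, fun h => isSquare_mul_of_not_isSquare h2 ha h⟩
  have : a = a * b / b := by field_simp
  rw [this]
  exact h.div hb

theorem exists_not_isSquare (h2 : (2 : F) ≠ 0) : ∃ a : F, ¬ IsSquare a :=
  FiniteField.exists_nonsquare (ringChar_ne_two_of_two_ne_zero h2)

/-- A nondegenerate binary diagonal form represents every value. -/
theorem exists_mul_sq_add_mul_sq_eq (h2 : (2 : F) ≠ 0) {a b : F} (ha : a ≠ 0) (hb : b ≠ 0)
    (c : F) : ∃ x y : F, a * x ^ 2 + b * y ^ 2 = c := by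
  have hF := ringChar_ne_two_of_two_ne_zero h2
  have hodd : Fintype.card F % 2 = 1 := FiniteField.odd_card_of_char_ne_two hF
  obtain ⟨x, y, h⟩ := FiniteField.exists_root_sum_quadratic
    (f := Polynomial.C a * Polynomial.X ^ 2 + Polynomial.C 0 * Polynomial.X + Polynomial.C (-c))
    (g := Polynomial.C b * Polynomial.X ^ 2 + Polynomial.C 0 * Polynomial.X + Polynomial.C 0)
    (Polynomial.degree_quadratic ha) (Polynomial.degree_quadratic hb) hodd
  refine ⟨x, y, ?_⟩
  simp at h
  linear_combination h

-- The product of `t` and the three quadratics has degree 7, less than the order of the field. All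
-- later choices that avoid finitely many bad values rest on this bound.
open Polynomial in
theorem exists_forall_quadratic_ne_zero (hq : 9 ≤ Fintype.card F) (b₁ c₁ b₂ c₂ b₃ c₃ : F) :
    ∃ t : F, t ≠ 0 ∧ t ^ 2 + b₁ * t + c₁ ≠ 0 ∧ t ^ 2 + b₂ * t + c₂ ≠ 0 ∧
      t ^ 2 + b₃ * t + c₃ ≠ 0 := by
  have hm : ∀ b c : F, (X ^ 2 + C b * X + C c).Monic := fun b c => by monicity!
  have hd : ∀ b c : F, (X ^ 2 + C b * X + C c).natDegree = 2 := fun b c => by compute_degree!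
  have hP := (((monic_X (R := F)).mul (hm b₁ c₁)).mul (hm b₂ c₂)).mul (hm b₃ c₃)
  have hdeg : (X * (X ^ 2 + C b₁ * X + C c₁) * (X ^ 2 + C b₂ * X + C c₂) *
      (X ^ 2 + C b₃ * X + C c₃)).natDegree = 7 := by
    rw [(((monic_X (R := F)).mul (hm b₁ c₁)).mul (hm b₂ c₂)).natDegree_mul (hm b₃ c₃),
      ((monic_X (R := F)).mul (hm b₁ c₁)).natDegree_mul (hm b₂ c₂),
      (monic_X (R := F)).natDegree_mul (hm b₁ c₁), hd, hd, hd, natDegree_X]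
  obtain ⟨t, ht⟩ := exists_eval_ne_zero_of_natDegree_lt_card _ hP.ne_zero (by
    rw [hdeg, Cardinal.mk_fintype]
    exact_mod_cast (by omega : 7 < Fintype.card F))
  simp only [eval_mul, eval_add, eval_pow, eval_X, eval_C, mul_ne_zero_iff] at ht
  exact ⟨t, ht.1.1.1, ht.1.1.2, ht.1.2, ht.2⟩

/-- A quadratic polynomial whose leading coefficient is a nonzero square takes a nonzero square
value outside of any two prescribed places. -/
theorem exists_quadratic_isSquare (h2 : (2 : F) ≠ 0) (hq : 9 ≤ Fintype.card F) {k : F}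
    (hk : k ≠ 0) (b c e₁ e₂ : F) :
    ∃ t, t ≠ e₁ ∧ t ≠ e₂ ∧ IsSquare (k ^ 2 * t ^ 2 + 2 * b * t + c) ∧
      k ^ 2 * t ^ 2 + 2 * b * t + c ≠ 0 := by
  -- Completing the square turns the task into solving `m ^ 2 + d = n ^ 2`. With the parameter `t =
  -- n - m` one has `m = (d / t - t) / 2` and `n = (d / t + t) / 2`; the three quadratics exclude `n
  -- = 0` and the two forbidden values of `m`.
  set d := c - (b / k) ^ 2 with hd
  set f₁ := k * e₁ + b / k with hf₁
  set f₂ := k * e₂ + b / k with hf₂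
  obtain ⟨t, ht, h0, h1, h3⟩ := exists_forall_quadratic_ne_zero hq 0 d (2 * f₁) (-d) (2 * f₂) (-d)
  have key : k ^ 2 * (((d / t - t) / 2 - b / k) / k) ^ 2 + 2 * b * (((d / t - t) / 2 - b / k) / k)
      + c = ((d / t + t) / 2) ^ 2 := by
    rw [show c = d + (b / k) ^ 2 by rw [hd]; ring]
    field_simp
    ring
  have hne : ∀ e f : F, f = k * e + b / k → t ^ 2 + 2 * f * t + -d ≠ 0 →
      ((d / t - t) / 2 - b / k) / k ≠ e := by
    rintro e f rfl h rfl
    apply h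
    field_simp
    ring
  refine ⟨((d / t - t) / 2 - b / k) / k, hne _ _ hf₁ h1, hne _ _ hf₂ h3, ?_, ?_⟩
  · rw [key]
    exact IsSquare.sq _
  · rw [key]
    refine pow_ne_zero 2 (div_ne_zero (fun h => h0 ?_) h2)
    field_simp at h
    linear_combination h

/-- A quadratic polynomial with nonzero discriminant whose leading coefficient is a nonzero
square takes a nonsquare value outside of any prescribed place. -/
theorem exists_quadratic_not_isSquare (h2 : (2 : F) ≠ 0) (hq : 9 ≤ Fintype.card F) {k : F}
    (hk : k ≠ 0) {b c : F} (hD : b ^ 2 ≠ k ^ 2 * c) (e : F) :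
    ∃ t, t ≠ e ∧ ¬ IsSquare (k ^ 2 * t ^ 2 + 2 * b * t + c) := by
  classical
  by_contra! hcon
  set d := c - (b / k) ^ 2 with hd
  have hd0 : d ≠ 0 := fun h => hD (by
    rw [hd] at h
    field_simp at h
    linear_combination -h)
  -- If all values off `e` were squares, this parametrisation of `m ^ 2 + d = n ^ 2` by units would
  -- reach all but at most one `m`. By counting it would be injective.
  let f : Fˣ → F := fun t => (d / t - t) / 2
  have hsurj : ∀ m, m ≠ k * e + b / k → ∃ t, f t = m := by
    intro m hm
    obtain ⟨n, hn⟩ := hcon ((m - b / k) / k) (by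
      rintro rfl
      apply hm
      field_simp
      ring)
    have hn' : (n - m) * (n + m) = d := by
      have : k ^ 2 * ((m - b / k) / k) ^ 2 + 2 * b * ((m - b / k) / k) + c = m ^ 2 + d := by
        rw [hd]
        field_simp
        ring
      rw [this] at hn
      linear_combination -hn
    have hnm : n - m ≠ 0 := fun h => hd0 (by rw [← hn', h, zero_mul])
    refine ⟨Units.mk0 _ hnm, ?_⟩
    change (d / (n - m) - (n - m)) / 2 = m
    rw [← hn']
    field_simp
    ring
  have hcard : Fintype.card Fˣ ≤ (Finset.univ.image f).card := by
    have hsub : Finset.univ.erase (k * e + b / k) ⊆ Finset.univ.image f := by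
      intro m hm
      obtain ⟨t, ht⟩ := hsurj m (Finset.ne_of_mem_erase hm)
      exact Finset.mem_image.2 ⟨t, Finset.mem_univ _, ht⟩
    have := Finset.card_le_card hsub
    rw [Finset.card_erase_of_mem (Finset.mem_univ _), Finset.card_univ] at this
    rwa [Fintype.card_units]
  have hinj : Function.Injective f := by
    have := Finset.card_image_iff.1 (le_antisymm Finset.card_image_le 
      ((Finset.card_univ (α := Fˣ)).trans_le hcard))
    simpa using this
  -- But `f` takes the same value at `t` and `-d / t`, which differ for suitable `t`.
  obtain ⟨t, ht, h0, -, -⟩ := exists_forall_quadratic_ne_zero hq 0 d 0 0 0 0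
  have hdt : -d / t ≠ 0 := div_ne_zero (neg_ne_zero.2 hd0) ht
  have heq : f (Units.mk0 t ht) = f (Units.mk0 _ hdt) := by
    change (d / t - t) / 2 = (d / (-d / t) - (-d / t)) / 2
    field_simp
    ring
  have h1 : t = -d / t := congrArg Units.val (hinj heq)
  apply h0
  field_simp at h1
  linear_combination h1

theorem exists_not_isSquare_ne (h2 : (2 : F) ≠ 0) (hq : 9 ≤ Fintype.card F) (c₁ c₂ : F) :
    ∃ a : F, ¬ IsSquare a ∧ a ≠ c₁ ∧ a ≠ c₂ := by
  obtain ⟨n, hn⟩ := exists_not_isSquare (F := F) h2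
  have hn0 : n ≠ 0 := by rintro rfl; exact hn IsSquare.zero
  obtain ⟨t, ht, h1, h3, -⟩ := exists_forall_quadratic_ne_zero hq 0 (-c₁ / n) 0 (-c₂ / n) 0 0
  refine ⟨t ^ 2 * n, fun h => hn ((isSquare_sq_mul_iff ht).1 h), ?_, ?_⟩
  · rintro rfl
    apply h1
    field_simp
    ring
  · rintro rfl
    apply h3
    field_simp
    ring

end FiniteFields

/-! ### Local systems on a pregeometry -/

namespace Pregeometry

/-- A local system on the incidence graph of a pregeometry: every element `x` carries the fibre
`{e | fiber x e}`, and `act y` transports the fibres of the elements incident with `y` to the fibre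
of `y`, trivially around triangles. -/
structure LocalSystem {X : Type u} {I : Type v} (G : Pregeometry X I) (E : Type u) where
  fiber : X → E → Prop
  act : X → E → E
  fiber_act : ∀ x y e, fiber x e → G.inc x y → fiber y (act y e)
  act_self : ∀ x e, fiber x e → act x e = e
  act_act : ∀ x y z e, fiber x e → G.inc x y → G.inc y z → G.inc x z →
    act z (act y e) = act z e

variable {X : Type u} {I : Type v} (G : Pregeometry X I)

theorem ElementaryInsertion.append_right {G : Pregeometry X I} {l m : List X}
    (h : G.ElementaryInsertion l m) (n : List X) :
    G.ElementaryInsertion (l ++ n) (m ++ n) := by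
  rcases h with ⟨l₁, l₂, x⟩ | ⟨l₁, l₂, x, y, hxy⟩ | ⟨l₁, l₂, x, y, z, hxy, hyz, hzx⟩
  · simpa [List.append_assoc] using ElementaryInsertion.repetition (G := G) l₁ (l₂ ++ n) x
  · simpa [List.append_assoc] using ElementaryInsertion.return (G := G) l₁ (l₂ ++ n) x y hxy
  · simpa [List.append_assoc] using
      ElementaryInsertion.triangle (G := G) l₁ (l₂ ++ n) x y z hxy hyz hzx

theorem Homotopic.append_right {G : Pregeometry X I} {l m : List X}
    (h : G.Homotopic l m) (n : List X) : G.Homotopic (l ++ n) (m ++ n) := by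
  induction h with
  | rel _ _ h => exact .rel _ _ (h.append_right n)
  | refl => exact .refl _
  | symm _ _ _ ih => exact ih.symm
  | trans _ _ _ _ _ ih₁ ih₂ => exact ih₁.trans _ _ _ ih₂

/-- Lists of elements up to homotopy. -/
def homotopySetoid : Setoid (List X) := Relation.EqvGen.setoid G.ElementaryInsertion

theorem mk_eq_mk_iff {l m : List X} :
    (Quotient.mk G.homotopySetoid l = Quotient.mk G.homotopySetoid m) ↔ G.Homotopic l m :=
  Quotient.eq (r := G.homotopySetoid)

/-- The local system of homotopy classes of paths. -/
def homotopySystem : G.LocalSystem (Quotient G.homotopySetoid) where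
  fiber x e := ∃ l, e = Quotient.mk _ (l ++ [x])
  act y := Quotient.map (· ++ [y]) fun _ _ h => Homotopic.append_right h [y]
  fiber_act := by
    rintro x y _ ⟨l, rfl⟩ -
    exact ⟨l ++ [x], rfl⟩
  act_self := by
    rintro x _ ⟨l, rfl⟩
    refine Quotient.sound (Relation.EqvGen.symm _ _ (.rel _ _ ?_))
    simpa using ElementaryInsertion.repetition (G := G) l [] x
  act_act := by
    rintro x y z _ ⟨l, rfl⟩ hxy hyz hxz
    refine Quotient.sound (Relation.EqvGen.symm _ _ ?_)
    -- The path `x, z` becomes `x, y, z, x, z` by a triangle at `x`, and the return `z, x, z` is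
    -- then removed.
    refine (Relation.EqvGen.rel _ _ ?_ : G.Homotopic (l ++ [x] ++ [z])
      (l ++ [x, y, z, x] ++ [z])).trans _ _ _ ?_
    · exact ElementaryInsertion.triangle l [z] x y z hxy hyz (G.inc_symm _ _ hxz)
    · refine Relation.EqvGen.symm _ _ (.rel _ _ ?_)
      simpa using ElementaryInsertion.return (G := G) (l ++ [x, y]) [] z x (G.inc_symm _ _ hxz)

/-- If every local system has a global section through every point of every fibre, then every
cycle is homotopic to a trivial one. -/
theorem homotopic_of_exists_section
    (h : ∀ (E : Type u) (L : G.LocalSystem E) (x : X) (e : E), L.fiber x e →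
      ∃ s : X → E, s x = e ∧ ∀ y z, G.inc y z → L.act z (s y) = s z)
    (x : X) (p : List X) (hp : G.IsCycleAt x p) : G.Homotopic p [x] := by
  obtain ⟨s, hsx, hs⟩ := h _ G.homotopySystem x (Quotient.mk _ [x]) ⟨[], rfl⟩
  obtain ⟨hc, hh, hl⟩ := hp
  -- Along any path from `x`, the section at the end point is the class of the path itself; for a
  -- closed path this is also the class of `[x]`.
  have key : ∀ q : List X, ∀ y, (q ++ [y]).IsChain G.inc → (q ++ [y]).head? = some x →
      Quotient.mk G.homotopySetoid (q ++ [y]) = s y := by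
    intro q
    induction q using List.reverseRecOn with
    | nil =>
      intro y _ hy
      have : y = x := by simpa using hy
      rw [this, hsx]
      rfl
    | append_singleton q z ih =>
      intro y hq hy
      have hzy : G.inc z y := by
        rw [List.append_assoc, List.isChain_append] at hq
        have := hq.2.1
        simpa using this
      rw [← hs z y hzy, ← ih z (List.IsChain.left_of_append hq) (by
        cases q <;> simpa using hy)]
      rfl
  have hne : p ≠ [] := by
    rintro rfl
    simp at hh
  obtain ⟨q, y, rfl⟩ : ∃ q y, p = q ++ [y] := ⟨_, _, (List.dropLast_append_getLast hne).symm⟩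
  have hy : y = x := by simpa using hl
  subst hy
  rw [← mk_eq_mk_iff, key q y hc hh, hsx]

namespace LocalSystem

variable {G} {E : Type u} (L : G.LocalSystem E)

theorem act_act_self {x y : X} {e : E} (he : L.fiber x e) (h : G.inc x y) :
    L.act x (L.act y e) = e := by
  rw [L.act_act x y x e he h (G.inc_symm _ _ h) (G.inc_refl x), L.act_self x e he]

end LocalSystem

end Pregeometry

/-! ### Nondegenerate subspaces -/

section Nondegenerate

variable {F : Type u} {V : Type v} [Field F] [AddCommGroup V] [Module F V]
  {B : LinearMap.BilinForm F V}

theorem restrict_nondegenerate_iff (hs : B.IsSymm) (Y : Submodule F V) :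
    (B.restrict Y).Nondegenerate ↔ ∀ y ∈ Y, (∀ z ∈ Y, B y z = 0) → y = 0 := by
  constructor
  · intro h y hy hyz
    exact congrArg Subtype.val (h.1 ⟨y, hy⟩ fun z => hyz z z.2)
  · intro h
    refine ⟨fun y hy => Subtype.ext (h y y.2 fun z hz => hy ⟨z, hz⟩),
      fun y hy => Subtype.ext (h y y.2 fun z hz => ?_)⟩
    rw [hs.eq]
    exact hy ⟨z, hz⟩

theorem exists_eq_add_of_restrict_nondegenerate [FiniteDimensional F V] (hs : B.IsSymm)
    {X : Submodule F V} (hX : (B.restrict X).Nondegenerate) (v : V) :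
    ∃ x ∈ X, ∃ y, (∀ z ∈ X, B z y = 0) ∧ v = x + y := by
  have hc := LinearMap.BilinForm.isCompl_orthogonal_of_restrict_nondegenerate hs.isRefl hX
  have hv : v ∈ X ⊔ B.orthogonal X := by
    rw [hc.sup_eq_top]
    exact Submodule.mem_top
  obtain ⟨x, hx, y, hy, rfl⟩ := Submodule.mem_sup.1 hv
  exact ⟨x, hx, y, fun z hz => hy z hz, rfl⟩

theorem restrict_sup_span_nondegenerate (hs : B.IsSymm) {X : Submodule F V}
    (hX : (B.restrict X).Nondegenerate) {v : V} (hv : ∀ x ∈ X, B x v = 0) (hvv : B v v ≠ 0) :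
    (B.restrict (X ⊔ Submodule.span F {v})).Nondegenerate := by
  rw [restrict_nondegenerate_iff hs] at hX ⊢
  intro y hy h
  obtain ⟨x, hx, w, hw, rfl⟩ := Submodule.mem_sup.1 hy
  obtain ⟨c, rfl⟩ := Submodule.mem_span_singleton.1 hw
  have h1 := h v (Submodule.mem_sup_right (Submodule.mem_span_singleton_self v))
  have hc : c = 0 := by simpa [hv x hx, hvv] using h1
  subst hc
  have hx0 : x = 0 := hX x hx fun z hz => by simpa using h z (Submodule.mem_sup_left hz)
  simp [hx0]

theorem finrank_sup_span_singleton [FiniteDimensional F V]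
    {X : Submodule F V} {v : V} (hv : ∀ x ∈ X, B x v = 0) (hvv : B v v ≠ 0) :
    Module.finrank F ↥(X ⊔ Submodule.span F {v}) = Module.finrank F X + 1 := by
  have hd : X ⊓ Submodule.span F {v} = ⊥ := by
    rw [eq_bot_iff]
    rintro y ⟨hy, hy'⟩
    obtain ⟨c, rfl⟩ := Submodule.mem_span_singleton.1 hy'
    have := hv _ hy
    have hc : c = 0 := by simpa [hvv] using this
    simp [hc]
  have h := Submodule.finrank_sup_add_finrank_inf_eq X (Submodule.span F {v})
  rw [hd, finrank_bot, finrank_span_singleton (fun h0 => hvv (by simp [h0]))] at h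
  exact h

theorem restrict_inf_orthogonal_nondegenerate [FiniteDimensional F V] (hs : B.IsSymm)
    {X Y : Submodule F V} (hX : (B.restrict X).Nondegenerate) (hY : (B.restrict Y).Nondegenerate)
    (hXY : X ≤ Y) :
    (B.restrict (Y ⊓ B.orthogonal X)).Nondegenerate := by
  rw [restrict_nondegenerate_iff hs] at hY ⊢
  rintro z ⟨hzY, hzX⟩ h
  refine hY z hzY fun y hy => ?_
  obtain ⟨x, hx, w, hw, rfl⟩ := exists_eq_add_of_restrict_nondegenerate hs hX y
  rw [map_add, hs.eq z x, hzX x hx, h w ⟨?_, hw⟩, add_zero]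
  simpa using Y.sub_mem hy (hXY hx)

theorem finrank_inf_orthogonal [FiniteDimensional F V] (hs : B.IsSymm)
    {X Y : Submodule F V} (hX : (B.restrict X).Nondegenerate) (hXY : X ≤ Y) :
    Module.finrank F X + Module.finrank F ↥(Y ⊓ B.orthogonal X) = Module.finrank F Y := by
  have hc := LinearMap.BilinForm.isCompl_orthogonal_of_restrict_nondegenerate hs.isRefl hX
  have hsup : X ⊔ (Y ⊓ B.orthogonal X) = Y := by
    rw [inf_comm, ← sup_inf_assoc_of_le _ hXY, hc.sup_eq_top, top_inf_eq]
  have hinf : X ⊓ (Y ⊓ B.orthogonal X) = ⊥ := by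
    rw [inf_left_comm, hc.inf_eq_bot, inf_bot_eq]
  have h := Submodule.finrank_sup_add_finrank_inf_eq X (Y ⊓ B.orthogonal X)
  rw [hsup, hinf, finrank_bot] at h
  omega

/-- A nonzero nondegenerate subspace contains a nonsingular vector orthogonal to a given smaller
nondegenerate subspace. -/
theorem exists_orthogonal_ne_zero [FiniteDimensional F V] (hs : B.IsSymm) (h2 : (2 : F) ≠ 0)
    {X Y : Submodule F V} (hX : (B.restrict X).Nondegenerate) (hY : (B.restrict Y).Nondegenerate)
    (hXY : X ≤ Y) (hd : Module.finrank F X < Module.finrank F Y) :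
    ∃ v ∈ Y, (∀ x ∈ X, B x v = 0) ∧ B v v ≠ 0 := by
  have hZ := restrict_inf_orthogonal_nondegenerate hs hX hY hXY
  have hr := finrank_inf_orthogonal hs hX hXY
  rw [restrict_nondegenerate_iff hs] at hZ
  -- If all vectors of the orthogonal complement in `Y` were singular, polarisation would make the
  -- form vanish there.
  by_contra! hcon
  have hzero : ∀ z ∈ Y ⊓ B.orthogonal X, z = 0 := fun z hz => hZ z hz fun w hw => by
    have h1 := hcon _ (Submodule.add_mem _ hz hw).1 (fun x hx => (Submodule.add_mem _ hz hw).2 x hx)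
    have h3 := hcon z hz.1 (fun x hx => hz.2 x hx)
    have h4 := hcon w hw.1 (fun x hx => hw.2 x hx)
    simp only [map_add, LinearMap.add_apply, h3, h4, hs.eq w z] at h1
    have h5 : 2 * B z w = 0 := by linear_combination h1
    exact (mul_eq_zero.1 h5).resolve_left h2
  have : Y ⊓ B.orthogonal X = ⊥ := (Submodule.eq_bot_iff _).2 hzero
  rw [this, finrank_bot] at hr
  omega

/-- Over a finite field, a nondegenerate subspace contains vectors of every nonzero length
orthogonal to a given nondegenerate subspace of codimension at least two. -/
theorem exists_orthogonal_eq [Fintype F] [FiniteDimensional F V] (hs : B.IsSymm)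
    (h2 : (2 : F) ≠ 0) {X Y : Submodule F V} (hX : (B.restrict X).Nondegenerate)
    (hY : (B.restrict Y).Nondegenerate) (hXY : X ≤ Y)
    (hd : Module.finrank F X + 2 ≤ Module.finrank F Y) (c : F) :
    ∃ v ∈ Y, (∀ x ∈ X, B x v = 0) ∧ B v v = c := by
  obtain ⟨v, hvY, hvX, hv⟩ := exists_orthogonal_ne_zero hs h2 hX hY hXY (by omega)
  have hX' := restrict_sup_span_nondegenerate hs hX hvX hv
  have hr := finrank_sup_span_singleton hvX hv
  obtain ⟨w, hwY, hwX, hw⟩ := exists_orthogonal_ne_zero hs h2 hX' hY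
    (sup_le hXY ((Submodule.span_singleton_le_iff_mem _ _).2 hvY)) (by omega)
  obtain ⟨x, y, hxy⟩ := exists_mul_sq_add_mul_sq_eq h2 hv hw c
  have hvw : B v w = 0 := hwX v (Submodule.mem_sup_right (Submodule.mem_span_singleton_self v))
  refine ⟨x • v + y • w, Y.add_mem (Y.smul_mem _ hvY) (Y.smul_mem _ hwY), fun z hz => ?_, ?_⟩
  · simp [hvX z hz, hwX z (Submodule.mem_sup_left hz)]
  · simp [hvw, hs.eq w v]
    linear_combination hxy

theorem restrict_bot_nondegenerate (hs : B.IsSymm) :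
    (B.restrict (⊥ : Submodule F V)).Nondegenerate := by
  rw [restrict_nondegenerate_iff hs]
  intro y hy _
  simpa using hy

theorem restrict_top_nondegenerate (hs : B.IsSymm) (hn : B.Nondegenerate) :
    (B.restrict (⊤ : Submodule F V)).Nondegenerate := by
  rw [restrict_nondegenerate_iff hs]
  exact fun y _ h => hn.1 y fun z => h z Submodule.mem_top

theorem restrict_span_singleton_nondegenerate (hs : B.IsSymm) {v : V} (hv : B v v ≠ 0) :
    (B.restrict (Submodule.span F {v})).Nondegenerate := by
  have := restrict_sup_span_nondegenerate hs (restrict_bot_nondegenerate hs)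
    (v := v) (by rintro x hx; simp [(Submodule.mem_bot F).1 hx]) hv
  rwa [bot_sup_eq] at this

end Nondegenerate

/-! ### Elliptic lines -/

section Lines

variable {F : Type u} {V : Type v} [Field F] [AddCommGroup V] [Module F V]

/-- The negative of the determinant of the Gram matrix of two vectors. -/
def lineDiscr (B : LinearMap.BilinForm F V) (a b : V) : F := B a b ^ 2 - B a a * B b b

/-- Two vectors are elliptic neighbours if they span an elliptic line. -/
def Elliptic (B : LinearMap.BilinForm F V) (a b : V) : Prop := ¬ IsSquare (lineDiscr B a b)

variable {B : LinearMap.BilinForm F V}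

theorem lineDiscr_comm (hs : B.IsSymm) (a b : V) : lineDiscr B a b = lineDiscr B b a := by
  simp only [lineDiscr, hs.eq b a]
  ring

theorem Elliptic.symm (hs : B.IsSymm) {a b : V} (h : Elliptic B a b) : Elliptic B b a := by
  rwa [Elliptic, lineDiscr_comm hs]

theorem Elliptic.left_ne_zero {a b : V} (h : Elliptic B a b) : B a a ≠ 0 := fun h0 =>
  h (by rw [lineDiscr, h0, zero_mul, sub_zero]; exact IsSquare.sq _)

theorem Elliptic.right_ne_zero {a b : V} (h : Elliptic B a b) : B b b ≠ 0 := fun h0 =>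
  h (by rw [lineDiscr, h0, mul_zero, sub_zero]; exact IsSquare.sq _)

theorem Elliptic.lineDiscr_ne_zero {a b : V} (h : Elliptic B a b) : lineDiscr B a b ≠ 0 :=
  fun h0 => h (by rw [h0]; exact IsSquare.zero)

theorem lineDiscr_smul_add (hs : B.IsSymm) (a b : V) (t : F) :
    lineDiscr B a (t • a + b) = lineDiscr B a b := by
  simp [lineDiscr, hs.eq b a]
  ring

theorem lineDiscr_smul_add' (hs : B.IsSymm) (a b : V) (t : F) :
    lineDiscr B b (t • a + b) = t ^ 2 * lineDiscr B a b := by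
  simp [lineDiscr, hs.eq b a]
  ring

theorem lineDiscr_smul_add_eq (hs : B.IsSymm) (o b c : V) (t : F) :
    lineDiscr B o (t • b + c) = lineDiscr B o b * t ^ 2 +
      2 * (B o b * B o c - B o o * B b c) * t + lineDiscr B o c := by
  simp [lineDiscr, hs.eq c b]
  ring

theorem lineDiscr_smul_right (a b : V) (t : F) :
    lineDiscr B a (t • b) = t ^ 2 * lineDiscr B a b := by
  simp [lineDiscr]
  ring

theorem span_pair_eq_sup_span_singleton (o a : V) (t : F) :
    Submodule.span F {o, a} = Submodule.span F {o} ⊔ Submodule.span F {a - t • o} := by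
  have ho : o ∈ Submodule.span F {o, a} := Submodule.subset_span (by simp)
  have ha : a ∈ Submodule.span F {o, a} := Submodule.subset_span (by simp)
  have ho' := Submodule.mem_sup_left (T := Submodule.span F {a - t • o})
    (Submodule.mem_span_singleton_self (R := F) o)
  have ha' := Submodule.mem_sup_right (S := Submodule.span F {o})
    (Submodule.mem_span_singleton_self (R := F) (a - t • o))
  apply le_antisymm
  · rw [Submodule.span_le]
    rintro x (rfl | rfl)
    · exact ho'
    · have := Submodule.add_mem _ ha' (Submodule.smul_mem _ t ho')
      rwa [sub_add_cancel] at this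
  · refine sup_le ?_ ?_
    · simpa using ho
    · rw [Submodule.span_singleton_le_iff_mem]
      exact Submodule.sub_mem _ ha (Submodule.smul_mem _ t ho)

/-- The component of `a` orthogonal to `o`. -/
theorem orthogonal_component (hs : B.IsSymm) {o : V} (ho : B o o ≠ 0) (a : V) :
    B o (a - (B o a / B o o) • o) = 0 ∧
      B (a - (B o a / B o o) • o) (a - (B o a / B o o) • o) = - lineDiscr B o a / B o o := by
  constructor
  · simp [ho]
  · simp [lineDiscr, hs.eq a o]
    field_simp
    ring

theorem span_pair_nondegenerate [FiniteDimensional F V] (hs : B.IsSymm) {o a : V}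
    (ho : B o o ≠ 0) (hoa : lineDiscr B o a ≠ 0) :
    (B.restrict (Submodule.span F {o, a})).Nondegenerate ∧
      Module.finrank F (Submodule.span F {o, a}) = 2 := by
  obtain ⟨h1, h3⟩ := orthogonal_component hs ho a
  have h4 : B (a - (B o a / B o o) • o) (a - (B o a / B o o) • o) ≠ 0 := by
    rw [h3]
    exact div_ne_zero (neg_ne_zero.2 hoa) ho
  have h5 : ∀ x ∈ Submodule.span F {o}, B x (a - (B o a / B o o) • o) = 0 := by
    intro x hx
    obtain ⟨c, rfl⟩ := Submodule.mem_span_singleton.1 hx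
    rw [map_smul, LinearMap.smul_apply, h1, smul_zero]
  rw [span_pair_eq_sup_span_singleton o a (B o a / B o o)]
  refine ⟨restrict_sup_span_nondegenerate hs (restrict_span_singleton_nondegenerate hs ho) h5 h4,
    ?_⟩
  rw [finrank_sup_span_singleton h5 h4,
    finrank_span_singleton (fun h0 => ho (by simp [h0]))]

theorem apply_eq_zero_of_mem_span_pair {o a z : V} (ho : B o z = 0) (ha : B a z = 0) :
    ∀ x ∈ Submodule.span F {o, a}, B x z = 0 := by
  intro x hx
  obtain ⟨s, t, rfl⟩ := Submodule.mem_span_pair.1 hx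
  simp [ho, ha]

theorem exists_orthogonal_decomposition [FiniteDimensional F V] (hs : B.IsSymm) {o a : V}
    (ho : B o o ≠ 0) (hoa : lineDiscr B o a ≠ 0) (v : V) :
    ∃ (x y : F) (z : V), v = x • o + y • a + z ∧ B o z = 0 ∧ B a z = 0 := by
  obtain ⟨r, hr, z, hz, rfl⟩ :=
    exists_eq_add_of_restrict_nondegenerate hs (span_pair_nondegenerate hs ho hoa).1 v
  obtain ⟨x, y, rfl⟩ := Submodule.mem_span_pair.1 hr
  exact ⟨x, y, z, rfl, hz _ (Submodule.subset_span (by simp)),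
    hz _ (Submodule.subset_span (by simp))⟩

theorem elliptic_smul_add_left (hs : B.IsSymm) {a b : V} {t : F} (hab : Elliptic B a b) :
    Elliptic B a (t • a + b) := by
  rwa [Elliptic, lineDiscr_smul_add hs]

theorem elliptic_smul_add_right (hs : B.IsSymm) {a b : V} {t : F} (ht : t ≠ 0)
    (hab : Elliptic B a b) : Elliptic B b (t • a + b) := by
  rwa [Elliptic, lineDiscr_smul_add' hs, isSquare_sq_mul_iff ht]

/-- A singular vector orthogonal to an anisotropic line has a hyperbolic partner there. -/
theorem exists_hyperbolic_partner [FiniteDimensional F V] (hs : B.IsSymm)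
    (hn : B.Nondegenerate) (h2 : (2 : F) ≠ 0) {b c r : V} (hb : B b b ≠ 0) (hbc : lineDiscr B b c ≠ 0)
    (hbr : B b r = 0) (hcr : B c r = 0) (hr : B r r = 0) (hr0 : r ≠ 0) :
    ∃ r', B b r' = 0 ∧ B c r' = 0 ∧ B r' r' = 0 ∧ B r r' = 1 := by
  obtain ⟨v, hv⟩ : ∃ v, B r v ≠ 0 := by
    by_contra! h
    exact hr0 (hn.1 r h)
  obtain ⟨x, y, z, rfl, hbz, hcz⟩ := exists_orthogonal_decomposition hs hb hbc v
  have hrz : B r z ≠ 0 := by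
    simpa [hs.eq r b, hs.eq r c, hbr, hcr] using hv
  -- The scaling of `z` normalises its product with `r`; the multiple of `r` then cancels the
  -- length.
  refine ⟨(1 / B r z) • z - (B z z / (2 * B r z ^ 2)) • r, ?_, ?_, ?_, ?_⟩
  · simp [hbz, hbr]
  · simp [hcz, hcr]
  · simp [hr, hs.eq z r]
    field_simp
    ring
  · simp [hr, hrz]

variable [Fintype F]

theorem exists_orthogonal_triple [FiniteDimensional F V] (hs : B.IsSymm) (hn : B.Nondegenerate)
    (h2 : (2 : F) ≠ 0) (hdim : 5 ≤ Module.finrank F V) {o a z : V}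
    (ho : B o o ≠ 0) (hoa : lineDiscr B o a ≠ 0) (hoz : B o z = 0) (haz : B a z = 0)
    (hz : B z z ≠ 0) (c : F) :
    ∃ y, B o y = 0 ∧ B a y = 0 ∧ B z y = 0 ∧ B y y = c := by
  obtain ⟨hL, hr⟩ := span_pair_nondegenerate hs ho hoa
  have hLz := apply_eq_zero_of_mem_span_pair hoz haz
  obtain ⟨y, -, hy, hyc⟩ := exists_orthogonal_eq hs h2
    (restrict_sup_span_nondegenerate hs hL hLz hz) (restrict_top_nondegenerate hs hn) le_top
    (by rw [finrank_sup_span_singleton hLz hz, hr, finrank_top]; omega) c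
  exact ⟨y, hy _ (Submodule.mem_sup_left (Submodule.subset_span (by simp))),
    hy _ (Submodule.mem_sup_left (Submodule.subset_span (by simp))),
    hy _ (Submodule.mem_sup_right (Submodule.mem_span_singleton_self _)), hyc⟩

/-- Every elliptic line contains elliptic neighbours of every nonsingular vector. -/
theorem exists_elliptic_smul_add (hs : B.IsSymm) (h2 : (2 : F) ≠ 0) (hq : 9 ≤ Fintype.card F)
    {o b c : V} (ho : B o o ≠ 0) (hbc : Elliptic B b c) :
    ∃ t : F, t ≠ 0 ∧ Elliptic B o (t • b + c) := by
  simp only [Elliptic, lineDiscr_smul_add_eq hs]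
  -- Up to the factor `B o o`, the discriminant of the quadratic in `t` is the Gram determinant of
  -- `o, b, c`. If it vanishes, the nonsquare `D` times the quadratic is the square of a linear
  -- polynomial, so any `t` off its root works, and one of `1`, `-1` is such.
  by_cases hD : (B o b * B o c - B o o * B b c) ^ 2 = lineDiscr B o b * lineDiscr B o c
  · have hG : B o o * B b b * B c c + 2 * B o b * B b c * B o c - B o o * B b c ^ 2
        - B b b * B o c ^ 2 - B c c * B o b ^ 2 = 0 := by
      refine (mul_eq_zero.1 ?_).resolve_left ho
      simp only [lineDiscr] at hD
      linear_combination -hD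
    set D := lineDiscr B b c with hDdef
    have hD0 : D ≠ 0 := hbc.lineDiscr_ne_zero
    set x := B o b * B c c - B o c * B b c with hx
    set y := B b b * B o c - B b c * B o b with hy
    have key : ∀ t, D * (lineDiscr B o b * t ^ 2 +
        2 * (B o b * B o c - B o o * B b c) * t + lineDiscr B o c) = (y * t - x) ^ 2 := by
      intro t
      simp only [hDdef, hx, hy, lineDiscr]
      linear_combination (B b b * t ^ 2 + 2 * B b c * t + B c c) * hG
    have hxy : ¬ (x = 0 ∧ y = 0) := by
      rintro ⟨hx0, hy0⟩
      have hob : B o b = 0 := by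
        refine (mul_eq_zero.1 (?_ : D * B o b = 0)).resolve_left hD0
        simp only [hDdef, lineDiscr]
        linear_combination -B b b * (hx.symm.trans hx0) - B b c * (hy.symm.trans hy0)
      have hoc : B o c = 0 := by
        refine (mul_eq_zero.1 (?_ : D * B o c = 0)).resolve_left hD0
        simp only [hDdef, lineDiscr]
        linear_combination -B b c * (hx.symm.trans hx0) - B c c * (hy.symm.trans hy0)
      refine hD0 ((mul_eq_zero.1 (?_ : B o o * D = 0)).resolve_left ho)
      simp only [hob, hoc] at hG
      simp only [hDdef, lineDiscr]
      linear_combination -hG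
    obtain ⟨t, ht, hyt⟩ : ∃ t : F, t ≠ 0 ∧ y * t - x ≠ 0 := by
      by_cases h : y = x
      · refine ⟨-1, neg_ne_zero.2 one_ne_zero, fun h0 => hxy ?_⟩
        have : 2 * x = 0 := by
          rw [h] at h0
          linear_combination -h0
        have hx0 := (mul_eq_zero.1 this).resolve_left h2
        exact ⟨hx0, h.trans hx0⟩
      · exact ⟨1, one_ne_zero, by rwa [mul_one, sub_ne_zero]⟩
    refine ⟨t, ht, fun h => ?_⟩
    have h1 : IsSquare (D * (lineDiscr B o b * t ^ 2 +
        2 * (B o b * B o c - B o o * B b c) * t + lineDiscr B o c)) := by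
      rw [key]
      exact IsSquare.sq _
    refine (isSquare_mul_iff_of_not_isSquare h2 ?_ hbc).1 h1 h
    intro h0
    have := key t
    rw [h0, mul_zero] at this
    exact hyt (pow_eq_zero_iff two_ne_zero |>.1 this.symm)
  · set A := lineDiscr B o b
    set C := lineDiscr B o c
    set H := B o b * B o c - B o o * B b c
    by_cases hA : A = 0
    · have hH : H ≠ 0 := by
        rintro h
        rw [h, hA] at hD
        exact hD (by ring)
      obtain ⟨n, hn, hnC, -⟩ := exists_not_isSquare_ne h2 hq C C
      refine ⟨(n - C) / (2 * H), div_ne_zero (sub_ne_zero.2 hnC) (mul_ne_zero h2 hH), ?_⟩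
      convert hn using 2
      rw [hA]
      field_simp
      ring
    · by_cases hAs : IsSquare A
      · obtain ⟨k, hk⟩ := hAs
        rw [← pow_two] at hk
        have hk0 : k ≠ 0 := by
          rintro rfl
          exact hA (by rw [hk]; ring)
        rw [hk] at hD ⊢
        exact exists_quadratic_not_isSquare h2 hq hk0 hD 0
      -- For nonsquare `A`, substituting `t = s / A` makes the value equal to a monic quadratic in
      -- `s` divided by `A`; a nonzero square numerator gives a nonsquare.
      · obtain ⟨s, hs0, -, hsq, hne⟩ :=
          exists_quadratic_isSquare h2 hq one_ne_zero H (A * C) 0 0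
        refine ⟨s / A, div_ne_zero hs0 hA, fun h => hAs ?_⟩
        have : A = (1 ^ 2 * s ^ 2 + 2 * H * s + A * C) /
            (A * (s / A) ^ 2 + 2 * H * (s / A) + C) := by
          have h5 : A * (s / A) ^ 2 + 2 * H * (s / A) + C =
              (1 ^ 2 * s ^ 2 + 2 * H * s + A * C) / A := by
            field_simp
          rw [h5, div_div_cancel₀ hne]
        rw [this]
        exact hsq.div h

/-- If `o` and `a` span a hyperbolic line and `w` is nonsingular and orthogonal to both, then they
have a common elliptic neighbour in the span of `o`, `a` and `w`. -/
theorem exists_common_elliptic (hs : B.IsSymm) (h2 : (2 : F) ≠ 0) (hq : 9 ≤ Fintype.card F)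
    {o a w : V} (ho : B o o ≠ 0) (ha : B a a ≠ 0) (hoa0 : lineDiscr B o a ≠ 0)
    (hoa : IsSquare (lineDiscr B o a)) (how : B o w = 0) (haw : B a w = 0) (hw : B w w ≠ 0) :
    ∃ x y η : F, η ≠ 0 ∧ Elliptic B o (x • o + y • a + η • w) ∧
      Elliptic B a (x • o + y • a + η • w) := by
  obtain ⟨n, hn⟩ := exists_not_isSquare (F := F) h2
  obtain ⟨h1, h3⟩ := orthogonal_component hs ho a
  set a' := a - (B o a / B o o) • o with ha'
  have ha'0 : B a' a' ≠ 0 := by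
    rw [h3]
    exact div_ne_zero (neg_ne_zero.2 hoa0) ho
  -- A vector orthogonal to `o` of this length has line discriminant `n` with `o`. Adding a multiple
  -- of `o` afterwards keeps it a neighbour of `o` and can make it a neighbour of `a`.
  obtain ⟨ξ, η, hξη⟩ := exists_mul_sq_add_mul_sq_eq h2 ha'0 hw (-n / B o o)
  have ha'w : B a' w = 0 := by simp [ha', how, haw]
  have hyy : B (ξ • a' + η • w) (ξ • a' + η • w) = -n / B o o := by
    rw [← hξη]
    simp [ha'w, hs.eq w a']
    ring
  have hoy : lineDiscr B o (ξ • a' + η • w) = n := by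
    rw [lineDiscr, hyy]
    simp [h1, how]
    field_simp
  have hη : η ≠ 0 := by
    rintro rfl
    apply hn
    have : n = ξ ^ 2 * lineDiscr B o a := by
      rw [h3] at hξη
      field_simp at hξη
      linear_combination hξη
    rw [this]
    exact (IsSquare.sq ξ).mul hoa
  have hell : Elliptic B o (ξ • a' + η • w) := by rwa [Elliptic, hoy]
  obtain ⟨t, -, ht⟩ := exists_elliptic_smul_add hs h2 hq ha hell
  have heq : t • o + (ξ • a' + η • w) =
      (t - ξ * (B o a / B o o)) • o + ξ • a + η • w := by
    rw [ha']
    module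
  refine ⟨t - ξ * (B o a / B o o), ξ, η, hη, ?_, ?_⟩
  · rw [← heq, Elliptic, lineDiscr_smul_add hs]
    exact hell
  · rw [← heq]
    exact ht

/-- Two nonorthogonal nonsingular vectors in the orthogonal complement of a line span hyperbolic
lines with a third vector of this complement. -/
theorem exists_common_hyperbolic [FiniteDimensional F V] (hs : B.IsSymm) (hn : B.Nondegenerate)
    (h2 : (2 : F) ≠ 0) (hq : 9 ≤ Fintype.card F) (hdim : 5 ≤ Module.finrank F V) {o a z z' : V}
    (ho : B o o ≠ 0) (hoa : lineDiscr B o a ≠ 0) (hoz : B o z = 0) (haz : B a z = 0)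
    (hz : B z z ≠ 0) (hzz' : B z z' ≠ 0) :
    ∃ w, B o w = 0 ∧ B a w = 0 ∧ B w w ≠ 0 ∧
      (lineDiscr B z w ≠ 0 ∧ IsSquare (lineDiscr B z w)) ∧
      (lineDiscr B z' w ≠ 0 ∧ IsSquare (lineDiscr B z' w)) := by
  -- With this length both `z + y` and `z - y` are singular. They sum to `2 • z`, so `z'` is not
  -- orthogonal to one of them. Moving from `z` in that singular direction keeps the line with `z`
  -- hyperbolic, and the discriminant with `z'` is a quadratic with square leading coefficient.
  obtain ⟨y, hoy, hay, hzy, hyy⟩ := exists_orthogonal_triple hs hn h2 hdim ho hoa hoz haz hz (-B z z)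
  obtain ⟨σ, hσ, hne⟩ : ∃ σ : F, σ ^ 2 = 1 ∧ B z' z + σ * B z' y ≠ 0 := by
    by_contra! h
    have h1 := h 1 (by ring)
    have h3 := h (-1) (by ring)
    apply hzz'
    rw [hs.eq]
    refine (mul_eq_zero.1 (?_ : 2 * B z' z = 0)).resolve_left h2
    linear_combination h1 + h3
  obtain ⟨t, ht, ht', hsq, hsq0⟩ := exists_quadratic_isSquare h2 hq hne
    ((B z' z) * (B z' z + σ * B z' y) - B z' z' * B z z) ((B z' z) ^ 2 - B z' z' * B z z) 0 (-1 / 2)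
  have hyz : B y z = 0 := by rw [hs.eq, hzy]
  have hw : B (z + t • (z + σ • y)) (z + t • (z + σ • y)) = B z z * (1 + 2 * t) := by
    simp [hzy, hyz, hyy]
    linear_combination -t ^ 2 * B z z * hσ
  have hzw : lineDiscr B z (z + t • (z + σ • y)) = (t * B z z) ^ 2 := by
    rw [lineDiscr, hw]
    simp [hzy]
    ring
  have hzw' : lineDiscr B z' (z + t • (z + σ • y)) = (B z' z + σ * B z' y) ^ 2 * t ^ 2 +
      2 * ((B z' z) * (B z' z + σ * B z' y) - B z' z' * B z z) * t +
      ((B z' z) ^ 2 - B z' z' * B z z) := by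
    rw [lineDiscr, hw]
    simp
    ring
  refine ⟨z + t • (z + σ • y), by simp [hoz, hoy], by simp [haz, hay], ?_, ⟨?_, ?_⟩, ?_, ?_⟩
  · rw [hw]
    refine mul_ne_zero hz fun h => ht' ?_
    field_simp
    linear_combination h
  · rw [hzw]
    exact pow_ne_zero 2 (mul_ne_zero ht hz)
  · rw [hzw]
    exact IsSquare.sq _
  · rwa [hzw']
  · rwa [hzw']

end Lines

/-! ### Geometries of points and elliptic lines -/

/-- A pregeometry of subspaces of a quadratic space which contains all nonsingular points, all
elliptic lines and all nondegenerate `4`-spaces whose discriminant is a square, and whose further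
members have enough nonsingular vectors and elliptic lines. -/
structure EllipticModel {F : Type*} {V : Type*} [Field F] [AddCommGroup V] [Module F V]
    (B : LinearMap.BilinForm F V) {X : Type u} {I : Type v} (G : Pregeometry X I) where
  sub : X → Submodule F V
  sub_injective : Function.Injective sub
  inc_iff : ∀ x y, G.inc x y ↔ sub x ≤ sub y ∨ sub y ≤ sub x
  pt : V → X
  sub_pt : ∀ v, B v v ≠ 0 → sub (pt v) = Submodule.span F {v}
  ln : V → V → X
  sub_ln : ∀ a b, Elliptic B a b → sub (ln a b) = Submodule.span F {a, b}
  exists_solid : ∀ o a z w, B o o ≠ 0 → B z z ≠ 0 → lineDiscr B o a ≠ 0 → lineDiscr B z w ≠ 0 →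
    IsSquare (lineDiscr B o a * lineDiscr B z w) → B o z = 0 → B a z = 0 → B o w = 0 →
    B a w = 0 → ∃ x, o ∈ sub x ∧ a ∈ sub x ∧ z ∈ sub x ∧ w ∈ sub x
  exists_mem : ∀ x, ∃ v ∈ sub x, B v v ≠ 0
  exists_elliptic : ∀ x, ∀ v ∈ sub x, B v v ≠ 0 →
    sub x = Submodule.span F {v} ∨ ∃ u ∈ sub x, Elliptic B v u

namespace EllipticModel

open Pregeometry

variable {F : Type*} {V : Type*} [Field F] [AddCommGroup V] [Module F V]
  {B : LinearMap.BilinForm F V} {X : Type u} {I : Type v} {G : Pregeometry X I}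
  (M : EllipticModel B G) {E : Type u} (L : G.LocalSystem E)

/-- The transport from the point of `a` to the point of `b` through the line joining them. -/
def mv (a b : V) (e : E) : E := L.act (M.pt b) (L.act (M.ln a b) e)

/-- The transport along the triangle `a`, `b`, `c` is trivial. -/
def TriNull (a b c : V) : Prop :=
  ∀ e, L.fiber (M.pt a) e → M.mv L b c (M.mv L a b e) = M.mv L a c e

/-- The transport along the quadrangle `o`, `c`, `a`, `c'` is trivial. -/
def QuadNull (o a c c' : V) : Prop :=
  ∀ e, L.fiber (M.pt o) e → M.mv L c a (M.mv L o c e) = M.mv L c' a (M.mv L o c' e)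

variable {M L}

/-! ### Transport inside a single member -/

theorem inc_pt {a : V} {Y : X} (ha : B a a ≠ 0) (h : a ∈ M.sub Y) : G.inc (M.pt a) Y :=
  (M.inc_iff _ _).2 (Or.inl (by
    rw [M.sub_pt a ha]
    exact (Submodule.span_singleton_le_iff_mem _ _).2 h))

theorem inc_ln {a b : V} {Y : X} (hab : Elliptic B a b) (ha : a ∈ M.sub Y) (hb : b ∈ M.sub Y) :
    G.inc (M.ln a b) Y :=
  (M.inc_iff _ _).2 (Or.inl (by
    rw [M.sub_ln a b hab, Submodule.span_le]
    rintro x (rfl | rfl)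
    · exact ha
    · exact hb))

theorem left_mem_ln {a b : V} (hab : Elliptic B a b) : a ∈ M.sub (M.ln a b) := by
  rw [M.sub_ln a b hab]
  exact Submodule.subset_span (by simp)

theorem right_mem_ln {a b : V} (hab : Elliptic B a b) : b ∈ M.sub (M.ln a b) := by
  rw [M.sub_ln a b hab]
  exact Submodule.subset_span (by simp)

theorem fiber_ln {a b : V} (hab : Elliptic B a b) {e : E} (he : L.fiber (M.pt a) e) :
    L.fiber (M.ln a b) (L.act (M.ln a b) e) :=
  L.fiber_act _ _ _ he (inc_pt hab.left_ne_zero (left_mem_ln hab))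

theorem fiber_mv {a b : V} (hab : Elliptic B a b) {e : E} (he : L.fiber (M.pt a) e) :
    L.fiber (M.pt b) (M.mv L a b e) :=
  L.fiber_act _ _ _ (fiber_ln hab he)
    (G.inc_symm _ _ (inc_pt hab.right_ne_zero (right_mem_ln hab)))

/-- The point, the line and the next point all lie in `Y`, so only triangles are crossed. As `L.act
Y` is injective on the fibres over points of `Y`, closed walks inside `Y` act trivially. -/
theorem act_mv {a b : V} {Y : X} (hab : Elliptic B a b) (ha : a ∈ M.sub Y) (hb : b ∈ M.sub Y)
    {e : E} (he : L.fiber (M.pt a) e) : L.act Y (M.mv L a b e) = L.act Y e := by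
  rw [mv, L.act_act (M.ln a b) (M.pt b) Y _ (fiber_ln hab he)
      (G.inc_symm _ _ (inc_pt hab.right_ne_zero (right_mem_ln hab)))
      (inc_pt hab.right_ne_zero hb) (inc_ln hab ha hb),
    L.act_act (M.pt a) (M.ln a b) Y _ he (inc_pt hab.left_ne_zero (left_mem_ln hab))
      (inc_ln hab ha hb) (inc_pt hab.left_ne_zero ha)]

theorem eq_of_act_eq {a : V} {Y : X} (haa : B a a ≠ 0) (ha : a ∈ M.sub Y) {e e' : E}
    (he : L.fiber (M.pt a) e) (he' : L.fiber (M.pt a) e') (h : L.act Y e = L.act Y e') :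
    e = e' := by
  rw [← L.act_act_self he (inc_pt haa ha), h, L.act_act_self he' (inc_pt haa ha)]

theorem mv_mv_self (hs : B.IsSymm) {a b : V} (hab : Elliptic B a b) {e : E}
    (he : L.fiber (M.pt a) e) : M.mv L b a (M.mv L a b e) = e := by
  have ha := left_mem_ln (M := M) hab
  have hb := right_mem_ln (M := M) hab
  refine eq_of_act_eq hab.left_ne_zero ha (fiber_mv (hab.symm hs) (fiber_mv hab he)) he ?_
  rw [act_mv (hab.symm hs) hb ha (fiber_mv hab he), act_mv hab ha hb he]

theorem triNull_of_mem {a b c : V} {Y : X} (hab : Elliptic B a b) (hbc : Elliptic B b c)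
    (hac : Elliptic B a c) (ha : a ∈ M.sub Y) (hb : b ∈ M.sub Y) (hc : c ∈ M.sub Y) :
    M.TriNull L a b c := by
  intro e he
  refine eq_of_act_eq hbc.right_ne_zero hc (fiber_mv hbc (fiber_mv hab he)) (fiber_mv hac he) ?_
  rw [act_mv hbc hb hc (fiber_mv hab he), act_mv hab ha hb he, act_mv hac ha hc he]

theorem quadNull_of_mem {o a c c' : V} {Y : X} (hoc : Elliptic B o c) (hca : Elliptic B c a)
    (hoc' : Elliptic B o c') (hca' : Elliptic B c' a) (ho : o ∈ M.sub Y) (ha : a ∈ M.sub Y)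
    (hc : c ∈ M.sub Y) (hc' : c' ∈ M.sub Y) : M.QuadNull L o a c c' := by
  intro e he
  refine eq_of_act_eq hca.right_ne_zero ha (fiber_mv hca (fiber_mv hoc he))
    (fiber_mv hca' (fiber_mv hoc' he)) ?_
  rw [act_mv hca hc ha (fiber_mv hoc he), act_mv hoc ho hc he,
    act_mv hca' hc' ha (fiber_mv hoc' he), act_mv hoc' ho hc' he]

theorem TriNull.swap_left (hs : B.IsSymm) {a b c : V} (h : M.TriNull L a b c)
    (hab : Elliptic B a b) : M.TriNull L b a c := by
  intro e he
  rw [← h _ (fiber_mv (hab.symm hs) he), mv_mv_self hs (hab.symm hs) he]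

theorem TriNull.swap_right (hs : B.IsSymm) {a b c : V} (h : M.TriNull L a b c)
    (hab : Elliptic B a b) (hbc : Elliptic B b c) : M.TriNull L a c b := by
  intro e he
  rw [← h e he, mv_mv_self hs hbc (fiber_mv hab he)]

theorem QuadNull.swap (hs : B.IsSymm) {o a c c' : V} (h : M.QuadNull L c c' a o)
    (hoc : Elliptic B o c) (hca : Elliptic B c a) (hca' : Elliptic B c' a) :
    M.QuadNull L o a c c' := by
  intro e he
  have h1 := h _ (fiber_mv hoc he)
  rw [mv_mv_self hs hoc he] at h1
  rw [← h1, mv_mv_self hs (hca'.symm hs) (fiber_mv hca (fiber_mv hoc he))]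

/-! ### Quadrangles with a hyperbolic diagonal -/

theorem quadNull_of_decomposition {o a c c' z z' : V} {x y x' y' : F} (ho : B o o ≠ 0)
    (hoa0 : lineDiscr B o a ≠ 0) (hoa : IsSquare (lineDiscr B o a)) (hoz : B o z = 0)
    (haz : B a z = 0) (hoz' : B o z' = 0) (haz' : B a z' = 0) (hz : B z z ≠ 0)
    (hzz0 : lineDiscr B z z' ≠ 0) (hzz : IsSquare (lineDiscr B z z'))
    (hc : c = x • o + y • a + z) (hc' : c' = x' • o + y' • a + z')
    (hoc : Elliptic B o c) (hca : Elliptic B c a)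
    (hoc' : Elliptic B o c') (hca' : Elliptic B c' a) : M.QuadNull L o a c c' := by
  obtain ⟨Y, h1, h2, h3, h4⟩ :=
    M.exists_solid o a z z' ho hz hoa0 hzz0 (hoa.mul hzz) hoz haz hoz' haz'
  refine quadNull_of_mem hoc hca hoc' hca' h1 h2 ?_ ?_
  · rw [hc]
    exact add_mem (add_mem (Submodule.smul_mem _ _ h1) (Submodule.smul_mem _ _ h2)) h3
  · rw [hc']
    exact add_mem (add_mem (Submodule.smul_mem _ _ h1) (Submodule.smul_mem _ _ h2)) h4

variable [Fintype F] [FiniteDimensional F V]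

/-- When `z` and `z'` do not span a hyperbolic line, a vector `w` hyperbolic with both yields a
common neighbour of `o` and `a` with component along `w`, and each half of the quadrangle lies in a
positive solid. -/
theorem quadNull_of_apply_ne_zero (hs : B.IsSymm) (hn : B.Nondegenerate)
    (h2 : (2 : F) ≠ 0) (hq : 9 ≤ Fintype.card F) (hdim : 5 ≤ Module.finrank F V)
    {o a c c' z z' : V} {x y x' y' : F} (ho : B o o ≠ 0) (ha : B a a ≠ 0)
    (hoa0 : lineDiscr B o a ≠ 0) (hoa : IsSquare (lineDiscr B o a)) (hoz : B o z = 0)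
    (haz : B a z = 0) (hoz' : B o z' = 0) (haz' : B a z' = 0) (hz : B z z ≠ 0) (hz' : B z' z' ≠ 0)
    (hzz' : B z z' ≠ 0) (hc : c = x • o + y • a + z) (hc' : c' = x' • o + y' • a + z')
    (hoc : Elliptic B o c) (hca : Elliptic B c a)
    (hoc' : Elliptic B o c') (hca' : Elliptic B c' a) : M.QuadNull L o a c c' := by
  obtain ⟨w, how, haw, hw, ⟨hzw0, hzw⟩, hzw0', hzw'⟩ :=
    exists_common_hyperbolic hs hn h2 hq hdim ho hoa0 hoz haz hz hzz'
  obtain ⟨p, q, η, hη, h1, h3⟩ := exists_common_elliptic hs h2 hq ho ha hoa0 hoa how haw hw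
  have key : ∀ {c z : V} {x y : F}, B o z = 0 → B a z = 0 → B z z ≠ 0 → lineDiscr B z w ≠ 0 →
      IsSquare (lineDiscr B z w) → c = x • o + y • a + z → Elliptic B o c → Elliptic B c a →
      M.QuadNull L o a c (p • o + q • a + η • w) := by
    intro c z x y hoz haz hz hzw0 hzw hc hoc hca
    refine quadNull_of_decomposition (z := z) (z' := η • w) ho hoa0 hoa hoz haz
      (by rw [map_smul, how, smul_zero]) (by rw [map_smul, haw, smul_zero]) hz ?_ ?_ hc rfl hoc hca
      h1 (h3.symm hs)
    · rw [lineDiscr_smul_right]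
      exact mul_ne_zero (pow_ne_zero 2 hη) hzw0
    · rw [lineDiscr_smul_right]
      exact (IsSquare.sq η).mul hzw
  intro e he
  rw [key hoz haz hz hzw0 hzw hc hoc hca e he, key hoz' haz' hz' hzw0' hzw' hc' hoc' hca' e he]

/-- Quadrangles with a hyperbolic diagonal are null. -/
theorem quadNull_of_hyperbolic (hs : B.IsSymm) (hn : B.Nondegenerate)
    (h2 : (2 : F) ≠ 0) (hq : 9 ≤ Fintype.card F) (hdim : 5 ≤ Module.finrank F V)
    {o a c c' : V} (hoa0 : lineDiscr B o a ≠ 0) (hoa : IsSquare (lineDiscr B o a))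
    (hoc : Elliptic B o c) (hca : Elliptic B c a)
    (hoc' : Elliptic B o c') (hca' : Elliptic B c' a) : M.QuadNull L o a c c' := by
  have ho := hoc.left_ne_zero
  have ha := hca.right_ne_zero
  -- A singular component would make the discriminant of the line a square multiple of that of the
  -- hyperbolic line.
  have hne : ∀ {x y : F} {z : V}, B o z = 0 → B a z = 0 →
      Elliptic B o (x • o + y • a + z) → B z z ≠ 0 := by
    intro x y z hoz haz h hz
    apply h
    have : lineDiscr B o (x • o + y • a + z) = y ^ 2 * lineDiscr B o a := by
      simp [lineDiscr, hoz, haz, hz, hs.eq z o, hs.eq z a, hs.eq a o]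
      ring
    rw [this]
    exact (IsSquare.sq y).mul hoa
  obtain ⟨x, y, z, hc, hoz, haz⟩ := exists_orthogonal_decomposition hs ho hoa0 c
  obtain ⟨x', y', z', hc', hoz', haz'⟩ := exists_orthogonal_decomposition hs ho hoa0 c'
  have hz := hne hoz haz (hc ▸ hoc)
  have hz' := hne hoz' haz' (hc' ▸ hoc')
  by_cases hzz' : B z z' = 0
  · have hlz : lineDiscr B z z' = - (B z z * B z' z') := by rw [lineDiscr, hzz']; ring
    by_cases hsq : IsSquare (lineDiscr B z z')
    · refine quadNull_of_decomposition ho hoa0 hoa hoz haz hoz' haz' hz ?_ hsq hc hc' hoc hca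
        hoc' hca'
      rw [hlz]
      exact neg_ne_zero.2 (mul_ne_zero hz hz')
    · have hzz'' : B z' z = 0 := by rw [hs.eq, hzz']
      -- For orthogonal `z, z'`, the sum is orthogonal to neither and serves as intermediate
      -- direction. It is nonsingular, for otherwise the discriminant would be the square `B z z ^
      -- 2`.
      have how : B o (z + z') = 0 := by rw [map_add, hoz, hoz', add_zero]
      have haw : B a (z + z') = 0 := by rw [map_add, haz, haz', add_zero]
      have hw : B (z + z') (z + z') ≠ 0 := by
        simp only [map_add, LinearMap.add_apply, hzz', hzz'', add_zero, zero_add]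
        intro h
        apply hsq
        rw [hlz, show - (B z z * B z' z') = B z z ^ 2 by linear_combination -B z z * h]
        exact IsSquare.sq _
      obtain ⟨p, q, η, hη, h1, h3⟩ := exists_common_elliptic hs h2 hq ho ha hoa0 hoa how haw hw
      have key : ∀ {c z₁ : V} {x y : F}, B o z₁ = 0 → B a z₁ = 0 → B z₁ z₁ ≠ 0 →
          B z₁ (z + z') ≠ 0 → c = x • o + y • a + z₁ → Elliptic B o c → Elliptic B c a →
          M.QuadNull L o a c (p • o + q • a + η • (z + z')) := by
        intro c z₁ x y hoz₁ haz₁ hz₁ hzw hc hoc hca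
        refine quadNull_of_apply_ne_zero (z := z₁) (z' := η • (z + z')) hs hn h2 hq hdim ho ha hoa0
          hoa hoz₁ haz₁ (by rw [map_smul, how, smul_zero]) (by rw [map_smul, haw, smul_zero]) hz₁
          ?_ ?_ hc rfl hoc hca h1 (h3.symm hs)
        · rw [map_smul, map_smul, LinearMap.smul_apply, smul_eq_mul, smul_eq_mul]
          exact mul_ne_zero hη (mul_ne_zero hη hw)
        · rw [map_smul, smul_eq_mul]
          exact mul_ne_zero hη hzw
      intro e he
      rw [key hoz haz hz (by rwa [map_add, hzz', add_zero]) hc hoc hca e he,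
        key hoz' haz' hz' (by rwa [map_add, hzz'', zero_add]) hc' hoc' hca' e he]
  · exact quadNull_of_apply_ne_zero hs hn h2 hq hdim ho ha hoa0 hoa hoz haz hoz' haz' hz hz' hzz'
      hc hc' hoc hca hoc' hca'

/-! ### Triangles -/

theorem triNull_of_decomposition (hs : B.IsSymm) (hn : B.Nondegenerate)
    (h2 : (2 : F) ≠ 0) (hdim : 5 ≤ Module.finrank F V)
    {a b c z : V} {x y : F} (haz : B a z = 0) (hbz : B b z = 0) (hz : B z z ≠ 0)
    (hc : c = x • a + y • b + z) (hab : Elliptic B a b) (hbc : Elliptic B b c)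
    (hac : Elliptic B a c) : M.TriNull L a b c := by
  have ha := hab.left_ne_zero
  have hab0 := hab.lineDiscr_ne_zero
  -- This length gives `z, w` the same discriminant as `a, b`, so the solid they span together is
  -- positive.
  obtain ⟨w, haw, hbw, hzw, hw⟩ := exists_orthogonal_triple hs hn h2 hdim ha hab0 haz hbz hz
    (-lineDiscr B a b / B z z)
  have hlz : lineDiscr B z w = lineDiscr B a b := by
    rw [lineDiscr, hzw, hw]
    field_simp
    ring
  obtain ⟨Y, h1, h3, h4, -⟩ := M.exists_solid a b z w ha hz hab0 (by rwa [hlz])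
    (by rw [hlz]; exact IsSquare.mul_self _) haz hbz haw hbw
  refine triNull_of_mem hab hbc hac h1 h3 ?_
  rw [hc]
  exact add_mem (add_mem (Submodule.smul_mem _ _ h1) (Submodule.smul_mem _ _ h3)) h4

/-- The hard case is a nonzero singular component `r` of `a` orthogonal to `b, c`. A vector `X`
orthogonal to `b` and `c` is then a neighbour of both, their lengths having the same square class.
The triangle `b, c, X` lies in a positive solid, and the quadrangle `a, b, X, c` has a hyperbolic
diagonal. -/
theorem triNull_of_isSquare (hs : B.IsSymm) (hn : B.Nondegenerate)
    (h2 : (2 : F) ≠ 0) (hq : 9 ≤ Fintype.card F) (hdim : 5 ≤ Module.finrank F V)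
    {a b c : V} (hab : Elliptic B a b) (hbc : Elliptic B b c)
    (hac : Elliptic B a c) (hsq : IsSquare (B b b * B c c)) : M.TriNull L a b c := by
  have hb := hab.right_ne_zero
  have hc := hac.right_ne_zero
  have hbc0 := hbc.lineDiscr_ne_zero
  obtain ⟨x, y, r, ha, hbr, hcr⟩ := exists_orthogonal_decomposition hs hb hbc0 a
  by_cases hr : B r r = 0
  · by_cases hr0 : r = 0
    · have hbm := left_mem_ln (M := M) hbc
      have hcm := right_mem_ln (M := M) hbc
      refine triNull_of_mem hab hbc hac ?_ hbm hcm
      rw [ha, hr0, add_zero]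
      exact add_mem (Submodule.smul_mem _ _ hbm) (Submodule.smul_mem _ _ hcm)
    · obtain ⟨r', hbr', hcr', hr', hrr'⟩ :=
        exists_hyperbolic_partner hs hn h2 hb hbc0 hbr hcr hr hr0
      have hrr'' : B r' r = 1 := by rw [hs.eq, hrr']
      obtain ⟨n, hns⟩ := exists_not_isSquare (F := F) h2
      have hn0 : n ≠ 0 := by rintro rfl; exact hns IsSquare.zero
      -- The length of `X` is fixed as `-n / B b b`, while its product `g` with `a` stays free; `g`
      -- is chosen to make the line of `a` and `X` hyperbolic.
      obtain ⟨g, hg0, -, hg, hg'⟩ := exists_quadratic_isSquare h2 hq one_ne_zero 0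
        (n / B b b * B a a) 0 0
      set X := g • r' + ((-n / B b b) / (2 * g)) • r with hX
      have hbX : B b X = 0 := by simp [hX, hbr, hbr']
      have hcX : B c X = 0 := by simp [hX, hcr, hcr']
      have hrX : B r X = g := by simp [hX, hr, hrr']
      have hXX : B X X = -n / B b b := by
        rw [hX]
        simp [hr, hr', hrr', hrr'']
        field_simp
        ring
      have hbXe : Elliptic B b X := by
        rw [Elliptic, lineDiscr, hbX, hXX]
        convert hns using 2
        field_simp
        ring
      have hcXe : Elliptic B c X := by
        rw [Elliptic, lineDiscr, hcX, hXX]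
        intro h
        apply hns
        rw [← isSquare_mul_iff_of_isSquare (mul_ne_zero hb hc) hsq,
          ← isSquare_sq_mul_iff (inv_ne_zero hb)]
        convert h using 1
        field_simp
        ring
      have haX : B a X = g := by
        rw [ha]
        simp [hbX, hcX, hrX]
      have haXd : lineDiscr B a X = 1 ^ 2 * g ^ 2 + 2 * 0 * g + n / B b b * B a a := by
        rw [lineDiscr, haX, hXX]
        ring
      have hquad : M.QuadNull L a X b c := quadNull_of_hyperbolic hs hn h2 hq hdim
        (by rwa [haXd]) (by rwa [haXd]) hab hbXe hac hcXe
      have htri : M.TriNull L b c X := triNull_of_decomposition (x := 0) (y := 0) hs hn h2 hdim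
        hbX hcX (by rw [hXX]; exact div_ne_zero (neg_ne_zero.2 hn0) hb) (by simp) hbc hcXe hbXe
      intro e he
      rw [← htri.swap_right hs hbc hcXe _ (fiber_mv hab he), hquad e he,
        mv_mv_self hs hcXe (fiber_mv hac he)]
  · have h := triNull_of_decomposition (M := M) (L := L) hs hn h2 hdim hbr hcr hr ha hbc
      (hac.symm hs) (hab.symm hs)
    exact (h.swap_right hs hbc (hac.symm hs)).swap_left hs (hab.symm hs)

/-- Triangles of elliptic neighbours are null. -/
theorem triNull (hs : B.IsSymm) (hn : B.Nondegenerate)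
    (h2 : (2 : F) ≠ 0) (hq : 9 ≤ Fintype.card F) (hdim : 5 ≤ Module.finrank F V)
    {a b c : V} (hab : Elliptic B a b) (hbc : Elliptic B b c)
    (hac : Elliptic B a c) : M.TriNull L a b c := by
  by_cases h1 : IsSquare (B b b * B c c)
  · exact triNull_of_isSquare hs hn h2 hq hdim hab hbc hac h1
  by_cases h3 : IsSquare (B a a * B c c)
  · exact (triNull_of_isSquare hs hn h2 hq hdim (hab.symm hs) hac hbc h3).swap_left hs
      (hab.symm hs)
  -- Among three lengths, two have the same square class.
  · have h4 : IsSquare (B a a * B b b) := by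
      rw [← isSquare_sq_mul_iff hac.right_ne_zero]
      convert isSquare_mul_of_not_isSquare h2 h3 h1 using 1
      ring
    exact ((triNull_of_isSquare hs hn h2 hq hdim (hac.symm hs) hab (hbc.symm hs) h4).swap_left hs
      (hac.symm hs)).swap_right hs hac (hbc.symm hs)

/-! ### Arbitrary quadrangles -/

theorem quadNull_of_lineDiscr_ne_zero (hs : B.IsSymm) (hn : B.Nondegenerate)
    (h2 : (2 : F) ≠ 0) (hq : 9 ≤ Fintype.card F) (hdim : 5 ≤ Module.finrank F V)
    {o a c c' : V} (hoa0 : lineDiscr B o a ≠ 0)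
    (hoc : Elliptic B o c) (hca : Elliptic B c a)
    (hoc' : Elliptic B o c') (hca' : Elliptic B c' a) : M.QuadNull L o a c c' := by
  by_cases hoa : IsSquare (lineDiscr B o a)
  · exact quadNull_of_hyperbolic hs hn h2 hq hdim hoa0 hoa hoc hca hoc' hca'
  · intro e he
    rw [triNull hs hn h2 hq hdim hoc hca hoa e he, triNull hs hn h2 hq hdim hoc' hca' hoa e he]

/-- Quadrangles of elliptic neighbours are null. -/
theorem quadNull (hs : B.IsSymm) (hn : B.Nondegenerate)
    (h2 : (2 : F) ≠ 0) (hq : 9 ≤ Fintype.card F) (hdim : 5 ≤ Module.finrank F V)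
    {o a c c' : V} (hoc : Elliptic B o c) (hca : Elliptic B c a)
    (hoc' : Elliptic B o c') (hca' : Elliptic B c' a) : M.QuadNull L o a c c' := by
  by_cases hoa : lineDiscr B o a = 0
  swap
  · exact quadNull_of_lineDiscr_ne_zero hs hn h2 hq hdim hoa hoc hca hoc' hca'
  have hopp : ∀ {x}, Elliptic B o x → Elliptic B x a → lineDiscr B x c' ≠ 0 →
      M.QuadNull L o a x c' := fun hox hxa hx =>
    (quadNull_of_lineDiscr_ne_zero hs hn h2 hq hdim hx hxa (hca'.symm hs) (hox.symm hs)
      hoc').swap hs hox hxa hca'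
  by_cases hcc : lineDiscr B c c' = 0
  swap
  · exact hopp hoc hca hcc
  have hao : lineDiscr B a o = 0 := by rwa [lineDiscr_comm hs]
  have hc'c : lineDiscr B c' c = 0 := by rwa [lineDiscr_comm hs]
  have hc'o := (hoc'.symm hs).lineDiscr_ne_zero
  set h := B a o * B a c - B a a * B o c with hh
  set k := B c' o * B c' c - B c' c' * B o c with hk
  -- Replace `c` by `t • o + c` on the line of `o` and `c`. Since the diagonal `o, a` is degenerate,
  -- being a neighbour of `a` is a condition on an affine function of `t`. The excluded values of
  -- `t` are those making the diagonal to `c'` degenerate.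
  obtain ⟨t, ht, ht', hell⟩ : ∃ t : F, t ≠ 0 ∧ t ≠ -2 * k / lineDiscr B c' o ∧
      ¬ IsSquare (2 * h * t + lineDiscr B a c) := by
    by_cases h0 : h = 0
    · obtain ⟨t, ht, ht', -⟩ := exists_quadratic_isSquare h2 hq one_ne_zero 0 0 0
        (-2 * k / lineDiscr B c' o)
      refine ⟨t, ht, ht', ?_⟩
      rw [h0, mul_zero, zero_mul, zero_add]
      exact hca.symm hs
    · obtain ⟨n, hn', hn1, hn2⟩ := exists_not_isSquare_ne h2 hq (lineDiscr B a c)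
        (2 * h * (-2 * k / lineDiscr B c' o) + lineDiscr B a c)
      refine ⟨(n - lineDiscr B a c) / (2 * h),
        div_ne_zero (sub_ne_zero.2 hn1) (mul_ne_zero h2 h0), fun h4 => hn2 ?_, ?_⟩
      · rw [← h4]
        field_simp
        ring
      · convert hn' using 2
        field_simp
        ring
  have hax : Elliptic B a (t • o + c) := by
    rw [Elliptic, lineDiscr_smul_add_eq hs, hao, zero_mul, zero_add, ← hh]
    exact hell
  have hox : Elliptic B o (t • o + c) := by
    rwa [Elliptic, lineDiscr_smul_add hs]
  have hcx : Elliptic B c (t • o + c) := by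
    rw [Elliptic, lineDiscr_smul_add' hs, isSquare_sq_mul_iff ht]
    exact hoc
  have hxc' : lineDiscr B (t • o + c) c' ≠ 0 := by
    rw [lineDiscr_comm hs, lineDiscr_smul_add_eq hs, hc'c, add_zero, ← hk]
    intro h4
    have h5 : t * (lineDiscr B c' o * t + 2 * k) = 0 := by linear_combination h4
    apply ht'
    have h6 := (mul_eq_zero.1 h5).resolve_left ht
    field_simp
    linear_combination h6
  have hom := left_mem_ln (M := M) hoc
  have hcm := right_mem_ln (M := M) hoc
  have hxm := add_mem (Submodule.smul_mem _ t hom) hcm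
  intro e he
  -- The new quadrangle is null by its other diagonal, and differs from the old one by two
  -- triangles.
  rw [← hopp hox (hax.symm hs) hxc' e he,
    ← triNull_of_mem (M := M) (L := L) hoc hcx hox hom hcm hxm e he,
    triNull hs hn h2 hq hdim hcx (hax.symm hs) hca _ (fiber_mv hoc he)]

/-! ### Construction of global sections -/

theorem exists_elliptic_of_ne_zero (hs : B.IsSymm) (hn : B.Nondegenerate)
    (h2 : (2 : F) ≠ 0) (hdim : 5 ≤ Module.finrank F V) {a : V} (ha : B a a ≠ 0) :
    ∃ u, Elliptic B a u := by
  obtain ⟨n, hns⟩ := exists_not_isSquare (F := F) h2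
  obtain ⟨u, -, hu, huu⟩ := exists_orthogonal_eq hs h2
    (restrict_span_singleton_nondegenerate hs ha) (restrict_top_nondegenerate hs hn) le_top
    (by rw [finrank_span_singleton (fun h0 => ha (by simp [h0])), finrank_top]; omega)
    (-n / B a a)
  refine ⟨u, ?_⟩
  rw [Elliptic, lineDiscr, hu a (Submodule.mem_span_singleton_self a), huu]
  convert hns using 2
  field_simp
  ring

theorem exists_common_neighbour (hs : B.IsSymm) (hn : B.Nondegenerate)
    (h2 : (2 : F) ≠ 0) (hq : 9 ≤ Fintype.card F) (hdim : 5 ≤ Module.finrank F V) {o a : V}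
    (ho : B o o ≠ 0) (ha : B a a ≠ 0) : ∃ x, Elliptic B o x ∧ Elliptic B x a := by
  obtain ⟨u, hu⟩ := exists_elliptic_of_ne_zero hs hn h2 hdim ha
  obtain ⟨t, -, ht⟩ := exists_elliptic_smul_add hs h2 hq ho hu
  exact ⟨t • a + u, ht, (elliptic_smul_add_left hs hu).symm hs⟩

/-- Every point of a fibre over the point of `o` extends to a section over all points which is
compatible with the transport inside of every member of the geometry. -/
theorem exists_point_section (hs : B.IsSymm) (hn : B.Nondegenerate)
    (h2 : (2 : F) ≠ 0) (hq : 9 ≤ Fintype.card F) (hdim : 5 ≤ Module.finrank F V) {o : V}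
    (ho : B o o ≠ 0) {e : E} (he : L.fiber (M.pt o) e) :
    ∃ s : V → E, s o = e ∧ (∀ a, B a a ≠ 0 → L.fiber (M.pt a) (s a)) ∧
      ∀ Y a b, B a a ≠ 0 → B b b ≠ 0 → a ∈ M.sub Y → b ∈ M.sub Y →
        L.act Y (s a) = L.act Y (s b) := by
  have hex : ∀ a, ∃ x, B a a ≠ 0 → Elliptic B o x ∧ Elliptic B x a := fun a => by
    by_cases ha : B a a ≠ 0
    · obtain ⟨x, hx⟩ := exists_common_neighbour hs hn h2 hq hdim ho ha
      exact ⟨x, fun _ => hx⟩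
    · exact ⟨0, fun h => absurd h ha⟩
  choose x hx using hex
  let s : V → E := fun a => M.mv L (x a) a (M.mv L o (x a) e)
  have hs_eq : ∀ {a y}, Elliptic B o y → Elliptic B y a → s a = M.mv L y a (M.mv L o y e) := by
    intro a y hoy hya
    obtain ⟨h1, h3⟩ := hx a hya.right_ne_zero
    exact quadNull hs hn h2 hq hdim h1 h3 hoy hya e he
  have hs_mem : ∀ a, B a a ≠ 0 → L.fiber (M.pt a) (s a) := fun a ha =>
    fiber_mv (hx a ha).2 (fiber_mv (hx a ha).1 he)
  have hs_mv : ∀ {a b}, Elliptic B a b → M.mv L a b (s a) = s b := by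
    intro a b hab
    -- A neighbour of `o` on the line of `a` and `b`, distinct from both points, computes both
    -- section values; the remaining triangle lies in that line.
    obtain ⟨t, ht, hell⟩ := exists_elliptic_smul_add hs h2 hq ho hab
    have hax := elliptic_smul_add_left hs (t := t) hab
    have hbx := elliptic_smul_add_right hs ht hab
    have ham := left_mem_ln (M := M) hab
    have hbm := right_mem_ln (M := M) hab
    rw [hs_eq hell (hax.symm hs), hs_eq hell (hbx.symm hs)]
    exact triNull_of_mem (hax.symm hs) hab (hbx.symm hs)
      (add_mem (Submodule.smul_mem _ t ham) hbm) ham hbm _ (fiber_mv hell he)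
  refine ⟨s, ?_, hs_mem, ?_⟩
  · obtain ⟨h1, h3⟩ := hx o ho
    exact mv_mv_self hs h1 he
  · intro Y a b ha hb haY hbY
    rcases M.exists_elliptic Y b hbY hb with hY | ⟨u, huY, hbu⟩
    · rw [hY] at haY
      obtain ⟨k, rfl⟩ := Submodule.mem_span_singleton.1 haY
      have hk : k ≠ 0 := by
        rintro rfl
        exact ha (by simp)
      obtain ⟨h1, h3⟩ := hx b hb
      have h4 : Elliptic B (x b) (k • b) := by
        rwa [Elliptic, lineDiscr_smul_right, isSquare_sq_mul_iff hk]
      have hpt : M.pt (k • b) = M.pt b := M.sub_injective (by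
        rw [M.sub_pt _ ha, M.sub_pt _ hb, Submodule.span_singleton_smul_eq hk.isUnit])
      have hln : M.ln (x b) (k • b) = M.ln (x b) b := M.sub_injective (by
        rw [M.sub_ln _ _ h4, M.sub_ln _ _ h3, Submodule.span_insert,
          Submodule.span_singleton_smul_eq hk.isUnit, ← Submodule.span_insert])
      rw [hs_eq h1 h4, hs_eq h1 h3]
      simp only [mv, hpt, hln]
    -- The elliptic line of `b` and `u` lies in `Y` and contains a neighbour of `a`, which joins `a`
    -- to `b` inside `Y`.
    · obtain ⟨t, -, hell⟩ := exists_elliptic_smul_add hs h2 hq ha hbu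
      have hbx := elliptic_smul_add_left hs (t := t) hbu
      have hxY := add_mem (Submodule.smul_mem _ t hbY) huY
      rw [← act_mv hell haY hxY (hs_mem a ha), hs_mv hell,
        ← act_mv hbx hbY hxY (hs_mem b hb), hs_mv hbx]

theorem exists_section (M : EllipticModel B G) (L : G.LocalSystem E)
    (hs : B.IsSymm) (hn : B.Nondegenerate)
    (h2 : (2 : F) ≠ 0) (hq : 9 ≤ Fintype.card F) (hdim : 5 ≤ Module.finrank F V) (x : X) (e : E)
    (he : L.fiber x e) : ∃ s : X → E, s x = e ∧ ∀ y z, G.inc y z → L.act z (s y) = s z := by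
  choose v hv hvv using M.exists_mem
  have hinc : ∀ y, G.inc (M.pt (v y)) y := fun y => inc_pt (hvv y) (hv y)
  obtain ⟨s, hso, hsf, hsY⟩ := exists_point_section (M := M) (L := L) hs hn h2 hq hdim (hvv x)
    (L.fiber_act _ _ _ he (G.inc_symm _ _ (hinc x)))
  refine ⟨fun y => L.act y (s (v y)), ?_, ?_⟩
  · change L.act x (s (v x)) = e
    rw [hso, L.act_act_self he (G.inc_symm _ _ (hinc x))]
  · intro y z hyz
    change L.act z (L.act y (s (v y))) = L.act z (s (v z))
    rcases (M.inc_iff y z).1 hyz with h | h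
    · rw [L.act_act _ _ _ _ (hsf _ (hvv y)) (hinc y) hyz (inc_pt (hvv y) (h (hv y))),
        hsY z _ _ (hvv y) (hvv z) (h (hv y)) (hv z)]
    · rw [hsY y _ _ (hvv y) (hvv z) (hv y) (h (hv z)),
        L.act_act _ _ _ _ (hsf _ (hvv z)) (inc_pt (hvv z) (h (hv z))) hyz (hinc z)]

theorem isConnected (M : EllipticModel B G) (hs : B.IsSymm) (hn : B.Nondegenerate)
    (h2 : (2 : F) ≠ 0) (hq : 9 ≤ Fintype.card F) (hdim : 5 ≤ Module.finrank F V) :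
    G.IsConnected := by
  refine ⟨⟨M.pt 0⟩, fun x y => ?_⟩
  obtain ⟨a, hax, ha⟩ := M.exists_mem x
  obtain ⟨b, hby, hb⟩ := M.exists_mem y
  obtain ⟨c, hac, hcb⟩ := exists_common_neighbour hs hn h2 hq hdim ha hb
  refine .head (G.inc_symm _ _ (inc_pt ha hax)) (.head (inc_pt ha (left_mem_ln hac))
    (.head (G.inc_symm _ _ (inc_pt hac.right_ne_zero (right_mem_ln hac)))
    (.head (inc_pt hcb.left_ne_zero (left_mem_ln hcb))
    (.head (G.inc_symm _ _ (inc_pt hb (right_mem_ln hcb))) (.single (inc_pt hb hby))))))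

theorem isSimplyConnected (M : EllipticModel B G) (hG : G.IsGeometry) (hs : B.IsSymm)
    (hn : B.Nondegenerate) (h2 : (2 : F) ≠ 0) (hq : 9 ≤ Fintype.card F)
    (hdim : 5 ≤ Module.finrank F V) : G.IsSimplyConnected :=
  ⟨hG, M.isConnected hs hn h2 hq hdim, G.homotopic_of_exists_section fun _ L x e he =>
    M.exists_section L hs hn h2 hq hdim x e he⟩

end EllipticModel

/-! ### Orthogonal frames, signs and Witt's theorem -/

section Frames

variable {F : Type u} {V : Type v} [Field F] [AddCommGroup V] [Module F V]
  {B : LinearMap.BilinForm F V}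

/-- A finite orthogonal family of nonsingular vectors. -/
def IsOrthFrame (B : LinearMap.BilinForm F V) {n : ℕ} (v : Fin n → V) : Prop :=
  (∀ i j, i ≠ j → B (v i) (v j) = 0) ∧ ∀ i, B (v i) (v i) ≠ 0

theorem IsOrthFrame.linearIndependent {n : ℕ} {v : Fin n → V} (hv : IsOrthFrame B v) :
    LinearIndependent F v :=
  LinearMap.BilinForm.linearIndependent_of_iIsOrtho (B := B) (fun i j h => hv.1 i j h)
    fun i => hv.2 i

theorem IsOrthFrame.finrank_span {n : ℕ} {v : Fin n → V} (hv : IsOrthFrame B v) :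
    Module.finrank F (Submodule.span F (Set.range v)) = n := by
  rw [finrank_span_eq_card hv.linearIndependent, Fintype.card_fin]

theorem IsOrthFrame.nondegenerate {n : ℕ} {v : Fin n → V} (hs : B.IsSymm)
    (hv : IsOrthFrame B v) :
    (B.restrict (Submodule.span F (Set.range v))).Nondegenerate := by
  rw [restrict_nondegenerate_iff hs]
  intro y hy h
  obtain ⟨c, rfl⟩ := (Submodule.mem_span_range_iff_exists_fun F).1 hy
  refine Finset.sum_eq_zero fun i _ => ?_
  have h1 := h (v i) (Submodule.subset_span ⟨i, rfl⟩)
  rw [map_sum, LinearMap.sum_apply, Finset.sum_eq_single i] at h1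
  · have hc : c i = 0 := by simpa [hv.2 i] using h1
    rw [hc, zero_smul]
  · intro j _ hj
    rw [map_smul, LinearMap.smul_apply, hv.1 j i hj, smul_zero]
  · simp

theorem IsOrthFrame.snoc (hs : B.IsSymm) {n : ℕ} {v : Fin n → V} {w : V} (hv : IsOrthFrame B v)
    (hw : ∀ i, B (v i) w = 0) (hww : B w w ≠ 0) :
    IsOrthFrame B (Fin.snoc v w : Fin (n + 1) → V) := by
  constructor
  · intro i j
    refine Fin.lastCases ?_ (fun i => ?_) i <;> refine Fin.lastCases ?_ (fun j => ?_) j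
    · simp
    · intro _
      simp [hs.eq w, hw]
    · intro _
      simp [hw]
    · intro h
      simpa using hv.1 i j (fun h' => h (by rw [h']))
  · intro i
    refine Fin.lastCases ?_ (fun i => ?_) i
    · simpa using hww
    · simpa using hv.2 i

theorem span_range_snoc {n : ℕ} (v : Fin n → V) (w : V) :
    Submodule.span F (Set.range (Fin.snoc v w : Fin (n + 1) → V)) =
      Submodule.span F (Set.range v) ⊔ Submodule.span F {w} := by
  rw [Fin.range_snoc, Submodule.span_insert, sup_comm]

theorem isOrthFrame_singleton {v : V} (hv : B v v ≠ 0) : IsOrthFrame B ![v] :=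
  ⟨fun i j h => absurd (Subsingleton.elim i j) h, fun i => by
    fin_cases i
    exact hv⟩

theorem isOrthFrame_pair (hs : B.IsSymm) {v w : V} (hv : B v v ≠ 0) (hw : B w w ≠ 0)
    (hvw : B v w = 0) : IsOrthFrame B ![v, w] := by
  have hwv : B w v = 0 := by rw [hs.eq, hvw]
  constructor
  · intro i j
    fin_cases i <;> fin_cases j <;> simp [hvw, hwv]
  · intro i
    fin_cases i
    · exact hv
    · exact hw

theorem isOrthFrame_quadruple (hs : B.IsSymm) {a b c d : V} (ha : B a a ≠ 0) (hb : B b b ≠ 0)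
    (hc : B c c ≠ 0) (hd : B d d ≠ 0) (hab : B a b = 0) (hac : B a c = 0) (had : B a d = 0)
    (hbc : B b c = 0) (hbd : B b d = 0) (hcd : B c d = 0) : IsOrthFrame B ![a, b, c, d] := by
  constructor
  · intro i j
    fin_cases i <;> fin_cases j <;>
      simp [hab, hac, had, hbc, hbd, hcd, hs.eq b a, hs.eq c a, hs.eq d a, hs.eq c b, hs.eq d b,
        hs.eq d c]
  · intro i
    fin_cases i
    · exact ha
    · exact hb
    · exact hc
    · exact hd

/-! ### Signs, reflections and conjugacy of subspaces -/

/-- A change of basis multiplies the Gram determinant by a nonzero square, so any orthogonal basis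
may replace the one in `signedDiscr`. -/
theorem isPositiveForm_iff_of_orthogonal_basis [Fintype F] {U : Type*} [AddCommGroup U]
    [Module F U] [FiniteDimensional F U] {C : LinearMap.BilinForm F U} (hC : C.Nondegenerate)
    {n : ℕ} (b : Module.Basis (Fin n) F U) (hb : ∀ i j, i ≠ j → C (b i) (b j) = 0) :
    IsPositiveForm C ↔ (IsSquare ((-1) ^ (n / 2) * ∏ i, C (b i) (b i)) ↔
      (Even n ∨ Fintype.card F % 4 = 1)) := by
  have hn : n = Module.finrank F U := by
    rw [Module.finrank_eq_card_basis b, Fintype.card_fin]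
  subst hn
  have hdet : (LinearMap.BilinForm.toMatrix b C).det = ∏ i, C (b i) (b i) := by
    have : LinearMap.BilinForm.toMatrix b C = Matrix.diagonal fun i => C (b i) (b i) := by
      ext i j
      rw [LinearMap.BilinForm.toMatrix_apply, Matrix.diagonal_apply]
      split_ifs with h
      · rw [h]
      · exact hb i j h
    rw [this, Matrix.det_diagonal]
  have hP := congrArg Matrix.det
    (LinearMap.BilinForm.toMatrix_mul_basis_toMatrix b (Module.finBasis F U) C)
  rw [Matrix.det_mul, Matrix.det_mul, Matrix.det_transpose, hdet] at hP
  have hP0 : (b.toMatrix (Module.finBasis F U)).det ≠ 0 := by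
    have := congrArg Matrix.det (b.toMatrix_mul_toMatrix_flip (Module.finBasis F U))
    rw [Matrix.det_mul, Matrix.det_one] at this
    exact left_ne_zero_of_mul_eq_one this
  rw [IsPositiveForm, and_iff_right hC, signedDiscr, ← hP,
    ← isSquare_sq_mul_iff (b := (-1) ^ (Module.finrank F U / 2) * ∏ i, C (b i) (b i)) hP0]
  refine iff_of_eq (congrArg (fun t => (IsSquare t ↔ _)) ?_)
  ring

theorem IsOrthFrame.isPositiveForm_iff [Fintype F] [FiniteDimensional F V] (hs : B.IsSymm)
    {n : ℕ} {v : Fin n → V} (hv : IsOrthFrame B v) {Y : Submodule F V}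
    (hY : Submodule.span F (Set.range v) = Y) :
    IsPositiveForm (B.restrict Y) ↔ (IsSquare ((-1) ^ (n / 2) * ∏ i, B (v i) (v i)) ↔
      (Even n ∨ Fintype.card F % 4 = 1)) := by
  subst hY
  let b := Module.Basis.span hv.linearIndependent
  have hb : ∀ i, ((b i : Submodule.span F (Set.range v)) : V) = v i := fun i =>
    congrArg Subtype.val (Module.Basis.span_apply hv.linearIndependent i)
  have h := isPositiveForm_iff_of_orthogonal_basis (hv.nondegenerate hs) b (fun i j hij => by
    change B (b i : V) (b j : V) = 0
    rw [hb, hb]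
    exact hv.1 i j hij)
  rw [h]
  have : ∀ i, (B.restrict (Submodule.span F (Set.range v))) (b i) (b i) = B (v i) (v i) := by
    intro i
    change B (b i : V) (b i : V) = _
    rw [hb]
  simp only [this]

variable [FiniteDimensional F V]

theorem exists_reflection (hs : B.IsSymm) {u : V} (hu : B u u ≠ 0) :
    ∃ r : V ≃ₗ[F] V, (∀ x y, B (r x) (r y) = B x y) ∧ LinearEquiv.det r = -1 ∧
      ∀ x, r x = x - (2 * B u x / B u u) • u := by
  have h : ((2 / B u u) • B u : Module.Dual F V) u = 2 := by
    simp [hu]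
  have happ : ∀ x, Module.reflection h x = x - (2 * B u x / B u u) • u := by
    intro x
    rw [Module.reflection_apply]
    congr 2
    simp
    ring
  refine ⟨Module.reflection h, fun x y => ?_, ?_, happ⟩
  · rw [happ, happ]
    simp [hs.eq _ u]
    field_simp
    ring
  · apply Units.ext
    rw [LinearEquiv.coe_det]
    have : ((Module.reflection h : V ≃ₗ[F] V) : V →ₗ[F] V) =
        LinearMap.transvection ((2 / B u u) • B u) (-u) := by
      ext x
      change Module.reflection h x = _
      rw [Module.reflection_apply, LinearMap.transvection.apply, smul_neg, sub_eq_add_neg]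
    rw [this, LinearMap.transvection.det, map_neg, h]
    norm_num

/-- Witt's theorem: two orthogonal frames with the same lengths are conjugate. -/
theorem IsOrthFrame.exists_isometry (hs : B.IsSymm) (h2 : (2 : F) ≠ 0) {n : ℕ}
    {v v' : Fin n → V} (hv : IsOrthFrame B v) (hv' : IsOrthFrame B v')
    (h : ∀ i, B (v i) (v i) = B (v' i) (v' i)) :
    ∃ g : V ≃ₗ[F] V, (∀ x y, B (g x) (g y) = B x y) ∧
      (LinearEquiv.det g = 1 ∨ LinearEquiv.det g = -1) ∧ ∀ i, g (v i) = v' i := by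
  induction n with
  | zero => exact ⟨1, fun _ _ => rfl, Or.inl (map_one _), fun i => i.elim0⟩
  | succ n ih =>
    obtain ⟨g, hg, hdet, hgv⟩ := ih (v := fun i => v i.castSucc) (v' := fun i => v' i.castSucc)
      ⟨fun i j hij => hv.1 _ _ (fun h => hij (Fin.castSucc_injective _ h)), fun i => hv.2 _⟩
      ⟨fun i j hij => hv'.1 _ _ (fun h => hij (Fin.castSucc_injective _ h)), fun i => hv'.2 _⟩
      (fun i => h _)
    set w := g (v (Fin.last n)) with hw
    set w' := v' (Fin.last n) with hw'
    have hww : B w w = B w' w' := by rw [hw, hg, h]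
    have hw'0 : B w' w' ≠ 0 := hv'.2 _
    have hwv : ∀ i : Fin n, B w (v' i.castSucc) = 0 := fun i => by
      rw [hw, ← hgv i, hg]
      exact hv.1 _ _ (Fin.castSucc_lt_last i).ne'
    have hwv' : ∀ i : Fin n, B w' (v' i.castSucc) = 0 := fun i =>
      hv'.1 _ _ (Fin.castSucc_lt_last i).ne'
    obtain ⟨r, hr, hrdet, hrw, hrv⟩ : ∃ r : V ≃ₗ[F] V, (∀ x y, B (r x) (r y) = B x y) ∧
        (LinearEquiv.det r = 1 ∨ LinearEquiv.det r = -1) ∧ r w = w' ∧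
        ∀ i : Fin n, r (v' i.castSucc) = v' i.castSucc := by
      by_cases hsub : B (w - w') (w - w') = 0
      -- The lengths of `w - w'` and `w + w'` add up to `4 * B w' w'`, so they are not both
      -- singular. Here the reflection in `w + w'` sends `w` to `-w'`, and the reflection in `w'`
      -- corrects the sign.
      · have hadd : B (w + w') (w + w') ≠ 0 := by
          intro hadd
          simp only [map_sub, map_add, LinearMap.sub_apply, LinearMap.add_apply] at hsub hadd
          have : 2 * (2 * B w' w') = 0 := by linear_combination hsub + hadd - 2 * hww
          exact mul_ne_zero h2 (mul_ne_zero h2 hw'0) this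
        obtain ⟨r, hr, hrd, hrx⟩ := exists_reflection hs hadd
        obtain ⟨t, ht, htd, htx⟩ := exists_reflection hs hw'0
        have hrw : r w = -w' := by
          have : 2 * B (w + w') w / B (w + w') (w + w') = 1 := by
            rw [div_eq_one_iff_eq hadd]
            simp only [map_add, LinearMap.add_apply, hs.eq w' w]
            linear_combination hww
          rw [hrx, this]
          module
        refine ⟨t * r, fun x y => ?_, Or.inl ?_, ?_, fun i => ?_⟩
        · rw [LinearEquiv.mul_apply, LinearEquiv.mul_apply, ht, hr]
        · rw [map_mul, htd, hrd, neg_mul_neg, mul_one]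
        · rw [LinearEquiv.mul_apply, hrw, htx]
          have : 2 * B w' (-w') / B w' w' = -2 := by
            rw [map_neg]
            field_simp
          rw [this]
          module
        · rw [LinearEquiv.mul_apply, hrx, map_add, LinearMap.add_apply, hwv, hwv', htx]
          simp [hwv']
      · obtain ⟨r, hr, hrd, hrx⟩ := exists_reflection hs hsub
        refine ⟨r, hr, Or.inr hrd, ?_, fun i => ?_⟩
        · have : 2 * B (w - w') w / B (w - w') (w - w') = 1 := by
            rw [div_eq_one_iff_eq hsub]
            simp only [map_sub, LinearMap.sub_apply, hs.eq w' w]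
            linear_combination hww
          rw [hrx, this]
          module
        · rw [hrx, map_sub, LinearMap.sub_apply, hwv, hwv']
          simp
    refine ⟨r * g, fun x y => ?_, ?_, fun i => ?_⟩
    · rw [LinearEquiv.mul_apply, LinearEquiv.mul_apply, hr, hg]
    · rw [map_mul]
      rcases hrdet with h | h <;> rcases hdet with h' | h' <;> simp [h, h']
    · refine Fin.lastCases ?_ (fun i => ?_) i
      · exact hrw
      · rw [LinearEquiv.mul_apply, hgv, hrv]

variable [Fintype F]

theorem exists_normal_frame_le (hs : B.IsSymm) (h2 : (2 : F) ≠ 0) {ν : F} (hν : ¬ IsSquare ν)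
    {Y : Submodule F V} (hY : (B.restrict Y).Nondegenerate) (k : ℕ)
    (hk : k ≤ Module.finrank F Y) :
    ∃ v : Fin k → V, IsOrthFrame B v ∧ Submodule.span F (Set.range v) ≤ Y ∧
      ∀ i, (i.val + 1 < Module.finrank F Y → B (v i) (v i) = 1) ∧
        (B (v i) (v i) = 1 ∨ B (v i) (v i) = ν) := by
  induction k with
  | zero => exact ⟨Fin.elim0, ⟨fun i => i.elim0, fun i => i.elim0⟩, by simp, fun i => i.elim0⟩
  | succ k ih =>
    obtain ⟨v, hv, hvY, hval⟩ := ih (by omega)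
    have hX := hv.nondegenerate hs
    have hr := hv.finrank_span
    have hν0 : ν ≠ 0 := by rintro rfl; exact hν IsSquare.zero
    obtain ⟨w, hwY, hwv, hw1, hw⟩ : ∃ w ∈ Y, (∀ x ∈ Submodule.span F (Set.range v), B x w = 0) ∧
        (k + 1 < Module.finrank F Y → B w w = 1) ∧ (B w w = 1 ∨ B w w = ν) := by
      by_cases hlt : k + 1 < Module.finrank F Y
      · obtain ⟨w, hwY, hwv, hw⟩ := exists_orthogonal_eq hs h2 hX hY hvY (by omega) 1
        exact ⟨w, hwY, hwv, fun _ => hw, Or.inl hw⟩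
      · obtain ⟨w, hwY, hwv, hw⟩ := exists_orthogonal_ne_zero hs h2 hX hY hvY (by omega)
        obtain ⟨c, hc⟩ : ∃ c : F, c ^ 2 * B w w = 1 ∨ c ^ 2 * B w w = ν := by
          by_cases hsq : IsSquare (B w w)
          · obtain ⟨m, hm⟩ := hsq
            have hm0 : m ≠ 0 := by
              rintro rfl
              exact hw (by rw [hm, zero_mul])
            refine ⟨1 / m, Or.inl ?_⟩
            rw [hm]
            field_simp
          · obtain ⟨m, hm⟩ := isSquare_mul_of_not_isSquare h2 hν hsq
            have hm0 : m ≠ 0 := by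
              rintro rfl
              rw [mul_zero] at hm
              exact mul_ne_zero hν0 hw hm
            refine ⟨ν / m, Or.inr ?_⟩
            field_simp
            linear_combination hm
        refine ⟨c • w, Y.smul_mem _ hwY, fun x hx => ?_, fun h => absurd h hlt, ?_⟩
        · rw [map_smul, hwv x hx, smul_zero]
        · simpa [pow_two, mul_assoc] using hc
    have hww : B w w ≠ 0 := by
      rcases hw with h | h <;> rw [h]
      · exact one_ne_zero
      · exact hν0
    refine ⟨Fin.snoc v w, hv.snoc hs (fun i => hwv _ (Submodule.subset_span ⟨i, rfl⟩)) hww, ?_, ?_⟩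
    · rw [span_range_snoc]
      exact sup_le hvY ((Submodule.span_singleton_le_iff_mem _ _).2 hwY)
    · intro i
      refine Fin.lastCases ?_ (fun i => ?_) i
      · simpa using ⟨hw1, hw⟩
      · simpa using hval i

/-- Every nondegenerate subspace has an orthogonal basis such that all vectors but the last one
have length `1`, and the length of the last one is `1` or a given nonsquare. -/
theorem exists_normal_frame (hs : B.IsSymm) (h2 : (2 : F) ≠ 0) {ν : F} (hν : ¬ IsSquare ν)
    {Y : Submodule F V} (hY : (B.restrict Y).Nondegenerate) {n : ℕ}
    (hn : Module.finrank F Y = n) :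
    ∃ v : Fin n → V, IsOrthFrame B v ∧ Submodule.span F (Set.range v) = Y ∧
      ∀ i, (i.val + 1 < n → B (v i) (v i) = 1) ∧ (B (v i) (v i) = 1 ∨ B (v i) (v i) = ν) := by
  subst hn
  obtain ⟨v, hv, hvY, hval⟩ := exists_normal_frame_le hs h2 hν hY _ le_rfl
  exact ⟨v, hv, Submodule.eq_of_le_of_finrank_eq hvY hv.finrank_span, hval⟩

/-- Nondegenerate subspaces of the same dimension and sign are conjugate under the special
orthogonal group. -/
theorem exists_specialOrthogonal_map_eq (hs : B.IsSymm) (h2 : (2 : F) ≠ 0)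
    {X Y : Submodule F V} (hX : (B.restrict X).Nondegenerate) (hY : (B.restrict Y).Nondegenerate)
    (hXY : Module.finrank F X = Module.finrank F Y) (hY0 : Y ≠ ⊥)
    (hpos : IsPositiveForm (B.restrict X) ↔ IsPositiveForm (B.restrict Y)) :
    ∃ g ∈ specialOrthogonal B, Y = X.map (g : V →ₗ[F] V) := by
  obtain ⟨ν, hν⟩ := exists_not_isSquare (F := F) h2
  have hν0 : ν ≠ 0 := by rintro rfl; exact hν IsSquare.zero
  obtain ⟨n, hn⟩ : ∃ n, Module.finrank F Y = n + 1 :=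
    Nat.exists_eq_succ_of_ne_zero fun h => hY0 (Submodule.finrank_eq_zero.1 h)
  obtain ⟨v, hv, hvX, hval⟩ := exists_normal_frame hs h2 hν hX (hXY.trans hn)
  obtain ⟨v', hv', hvY, hval'⟩ := exists_normal_frame hs h2 hν hY hn
  have hlt : ∀ i : Fin n, i.castSucc.val + 1 < n + 1 := fun i => by simp
  have heq : ∀ i, B (v i) (v i) = B (v' i) (v' i) := by
    intro i
    refine Fin.lastCases ?_ (fun i => ?_) i
    · rw [hv.isPositiveForm_iff hs hvX, hv'.isPositiveForm_iff hs hvY, Fin.prod_univ_castSucc,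
        Fin.prod_univ_castSucc] at hpos
      simp only [(hval _).1 (hlt _), (hval' _).1 (hlt _), Finset.prod_const_one, one_mul] at hpos
      -- Only the last lengths can differ, and `1` and `ν` yield opposite signs.
      have hpos' : IsSquare ((-1) ^ ((n + 1) / 2) * B (v (Fin.last n)) (v (Fin.last n))) ↔
          IsSquare ((-1) ^ ((n + 1) / 2) * B (v' (Fin.last n)) (v' (Fin.last n))) := by
        tauto
      have hne : IsSquare ((-1) ^ ((n + 1) / 2) : F) ↔
          ¬ IsSquare ((-1) ^ ((n + 1) / 2) * ν : F) := by
        rw [mul_comm, isSquare_mul_iff_of_not_isSquare h2 (by simp) hν, not_not]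
      rcases (hval (Fin.last n)).2 with h | h <;> rcases (hval' (Fin.last n)).2 with h' | h' <;>
        rw [h, h'] at hpos' ⊢ <;> rw [mul_one] at hpos' <;> tauto
    · rw [(hval _).1 (hlt _), (hval' _).1 (hlt _)]
  obtain ⟨g, hg, hdet, hgv⟩ := hv.exists_isometry hs h2 hv' heq
  have hmap : X.map (g : V →ₗ[F] V) = Y := by
    rw [← hvX, ← hvY, Submodule.map_span, ← Set.range_comp]
    congr 2
    ext i
    exact hgv i
  rcases hdet with hdet | hdet
  · exact ⟨g, ⟨hg, hdet⟩, hmap.symm⟩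
  -- A reflection in a vector of `Y` preserves `Y` and corrects the determinant.
  · obtain ⟨r, hr, hrd, hrx⟩ := exists_reflection hs (hv'.2 0)
    have hle : Y.map (r : V →ₗ[F] V) ≤ Y := by
      rintro _ ⟨y, hy, rfl⟩
      change r y ∈ Y
      rw [hrx]
      exact Y.sub_mem hy (Y.smul_mem _ (hvY ▸ Submodule.subset_span ⟨0, rfl⟩))
    refine ⟨r * g, ⟨fun x y => ?_, ?_⟩, ?_⟩
    · rw [LinearEquiv.mul_apply, LinearEquiv.mul_apply, hr, hg]
    · rw [map_mul, hrd, hdet, neg_mul_neg, mul_one]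
    · have h1 : X.map ((r * g : V ≃ₗ[F] V) : V →ₗ[F] V) = Y.map (r : V →ₗ[F] V) := by
        rw [← hmap, ← Submodule.map_comp]
        rfl
      rw [h1]
      exact (Submodule.eq_of_le_of_finrank_eq hle (LinearEquiv.finrank_map_eq r Y)).symm

/-- Between two nested nondegenerate subspaces there are nondegenerate subspaces of every
intermediate dimension and of both signs. -/
theorem exists_nondegenerate_between (hs : B.IsSymm) (h2 : (2 : F) ≠ 0) {X Y : Submodule F V}
    (hX : (B.restrict X).Nondegenerate) (hY : (B.restrict Y).Nondegenerate) (hXY : X ≤ Y)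
    {i : ℕ} (hi : Module.finrank F X < i) (hi' : i < Module.finrank F Y) (P : Prop) :
    ∃ Z, X ≤ Z ∧ Z ≤ Y ∧ (B.restrict Z).Nondegenerate ∧ Module.finrank F Z = i ∧
      (IsPositiveForm (B.restrict Z) ↔ P) := by
  obtain ⟨ν, hν⟩ := exists_not_isSquare (F := F) h2
  have hν0 : ν ≠ 0 := by rintro rfl; exact hν IsSquare.zero
  obtain ⟨k, hk⟩ : ∃ k, i = Module.finrank F X + 1 + k := ⟨_, (by omega : i = Module.finrank F X +
    1 + (i - (Module.finrank F X + 1)))⟩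
  induction k generalizing X with
  | zero =>
    obtain ⟨v, hv, hvX, -⟩ := exists_normal_frame hs h2 hν hX rfl
    set d := ((-1) ^ ((Module.finrank F X + 1) / 2) * ∏ i, B (v i) (v i)) with hd
    have hd0 : d ≠ 0 := mul_ne_zero (by simp) (Finset.prod_ne_zero_iff.2 fun i _ => hv.2 i)
    obtain ⟨c, hc0, hc⟩ : ∃ c : F, c ≠ 0 ∧ ((IsSquare (d * c) ↔
        (Even (Module.finrank F X + 1) ∨ Fintype.card F % 4 = 1)) ↔ P) := by
      have h1 : IsSquare (d * ν) ↔ ¬ IsSquare (d * 1) := by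
        rw [mul_comm, isSquare_mul_iff_of_not_isSquare h2 hd0 hν, mul_one]
      by_cases h : (IsSquare (d * 1) ↔
        (Even (Module.finrank F X + 1) ∨ Fintype.card F % 4 = 1)) ↔ P
      · exact ⟨1, one_ne_zero, h⟩
      · refine ⟨ν, hν0, ?_⟩
        rw [h1]
        tauto
    -- As `i` is strictly below the dimension of `Y`, the complement of `X` in `Y` has dimension at
    -- least two and represents both square classes.
    obtain ⟨w, hwY, hwX, hw⟩ := exists_orthogonal_eq hs h2 hX hY hXY (by omega) c
    have hww : B w w ≠ 0 := by rwa [hw]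
    refine ⟨X ⊔ Submodule.span F {w}, le_sup_left,
      sup_le hXY ((Submodule.span_singleton_le_iff_mem _ _).2 hwY),
      restrict_sup_span_nondegenerate hs hX hwX hww, ?_, ?_⟩
    · rw [finrank_sup_span_singleton hwX hww]
      omega
    · have hf := hv.snoc hs (w := w) (fun i => hwX _ (hvX ▸ Submodule.subset_span ⟨i, rfl⟩)) hww
      rw [hf.isPositiveForm_iff hs (Y := X ⊔ Submodule.span F {w}) (by rw [span_range_snoc, hvX]),
        Fin.prod_univ_castSucc]
      simp only [Fin.snoc_castSucc, Fin.snoc_last]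
      rw [← mul_assoc, hw]
      exact hc
  | succ k ih =>
    obtain ⟨w, hwY, hwX, hw⟩ := exists_orthogonal_ne_zero hs h2 hX hY hXY (by omega)
    have hr := finrank_sup_span_singleton hwX hw
    obtain ⟨Z, h1, h3⟩ := ih (restrict_sup_span_nondegenerate hs hX hwX hw)
      (sup_le hXY ((Submodule.span_singleton_le_iff_mem _ _).2 hwY)) (by omega) (by omega)
    exact ⟨Z, le_sup_left.trans h1, h3⟩

end Frames

/-! ### The geometry of an orbit of halls -/

namespace Pregeometry

/-- A pregeometry over a finite set of types is a geometry if every flag can be extended by an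
element of every missing type. -/
theorem isGeometry_of_exists_extension {X : Type u} {I : Type v} [Finite I]
    (G : Pregeometry X I)
    (h : ∀ A, G.IsFlag A → ∀ i ∉ G.typ '' A, ∃ x, G.typ x = i ∧ ∀ a ∈ A, G.inc a x) :
    G.IsGeometry := by
  suffices H : ∀ n A, G.IsFlag A → (G.typ '' A)ᶜ.ncard = n → ∃ C, G.IsChamber C ∧ A ⊆ C from
    fun A hA => H _ A hA rfl
  intro n
  induction n with
  | zero =>
    intro A hA hn
    exact ⟨A, ⟨hA, Set.compl_empty_iff.1 ((Set.ncard_eq_zero (Set.toFinite _)).1 hn)⟩, subset_rfl⟩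
  | succ n ih =>
    intro A hA hn
    obtain ⟨i, hi⟩ : ((G.typ '' A)ᶜ).Nonempty := by
      rw [Set.nonempty_iff_ne_empty]
      intro h0
      rw [h0, Set.ncard_empty] at hn
      omega
    obtain ⟨x, rfl, hx⟩ := h A hA i hi
    obtain ⟨C, hC, hAC⟩ := ih (insert x A) (by
      rintro a (rfl | ha) b (rfl | hb)
      · exact G.inc_refl _
      · exact G.inc_symm _ _ (hx b hb)
      · exact hx a ha
      · exact hA a ha b hb) (by
      have : (G.typ '' insert x A)ᶜ = (G.typ '' A)ᶜ \ {G.typ x} := by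
        rw [Set.image_insert_eq]
        ext i
        simp [not_or, and_comm]
      rw [this, Set.ncard_sdiff_singleton_of_mem hi, hn]
      rfl)
    exact ⟨C, hC, (Set.subset_insert _ _).trans hAC⟩

end Pregeometry

namespace NondegSubspace

variable {F : Type u} {V : Type v} [Field F] [AddCommGroup V] [Module F V]
  {B : LinearMap.BilinForm F V}

theorem carrier_injective : Function.Injective (carrier : NondegSubspace B → Submodule F V) := by
  rintro ⟨_, _, _, _⟩ ⟨_, _, _, _⟩ rfl
  rfl

variable [FiniteDimensional F V]

/-- The nondegenerate subspace spanned by an orthogonal frame. -/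
def ofFrame (hs : B.IsSymm) {n : ℕ} (v : Fin n → V) (hv : IsOrthFrame B v) (hn : 0 < n)
    (hn' : n < Module.finrank F V) : NondegSubspace B where
  carrier := Submodule.span F (Set.range v)
  ne_bot h := by
    have := hv.finrank_span
    rw [h, finrank_bot] at this
    omega
  ne_top h := by
    have := hv.finrank_span
    rw [h, finrank_top] at this
    omega
  nondegenerate := hv.nondegenerate hs

theorem exists_mem_ne_zero (hs : B.IsSymm) (h2 : (2 : F) ≠ 0) (x : NondegSubspace B) :
    ∃ v ∈ x.carrier, B v v ≠ 0 := by
  obtain ⟨v, hv, -, hvv⟩ := exists_orthogonal_ne_zero hs h2 (restrict_bot_nondegenerate hs)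
    x.nondegenerate bot_le (by
      rw [finrank_bot]
      exact Nat.pos_of_ne_zero fun h => x.ne_bot (Submodule.finrank_eq_zero.1 h))
  exact ⟨v, hv, hvv⟩

variable [Fintype F]

theorem mem_orbitSet (hs : B.IsSymm) (h2 : (2 : F) ≠ 0) {W : Set (NondegSubspace B)}
    {x w : NondegSubspace B} (hw : w ∈ W) (hdim : w.dim = x.dim)
    (hpos : w.IsPositive ↔ x.IsPositive) : x ∈ orbitSet W := by
  obtain ⟨g, hg, hgx⟩ := exists_specialOrthogonal_map_eq hs h2 w.nondegenerate x.nondegenerate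
    hdim x.ne_bot hpos
  exact ⟨g, hg, w, hw, hgx⟩

theorem exists_dim_eq_of_mem_orbitSet (hs : B.IsSymm) (h2 : (2 : F) ≠ 0)
    {W : Set (NondegSubspace B)} {x : NondegSubspace B} (hx : x ∈ orbitSet W) :
    ∃ w ∈ W, w.dim = x.dim ∧ (w.IsPositive ↔ x.IsPositive) := by
  obtain ⟨g, hg, w, hw, hgx⟩ := hx
  obtain ⟨ν, hν⟩ := exists_not_isSquare (F := F) h2
  have hdim : w.dim = x.dim := by
    rw [dim, dim, hgx]
    exact (LinearEquiv.finrank_map_eq g _).symm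
  refine ⟨w, hw, hdim, ?_⟩
  obtain ⟨n, hn⟩ : ∃ n, Module.finrank F w.carrier = n := ⟨_, rfl⟩
  obtain ⟨v, hv, hvw, -⟩ := exists_normal_frame hs h2 hν w.nondegenerate hn
  have hgv : IsOrthFrame B fun i => g (v i) :=
    ⟨fun i j hij => by rw [hg.1]; exact hv.1 i j hij, fun i => by rw [hg.1]; exact hv.2 i⟩
  have hgvx : Submodule.span F (Set.range fun i => g (v i)) = x.carrier := by
    rw [hgx, ← hvw, Submodule.map_span, ← Set.range_comp]
    rfl
  rw [IsPositive, IsPositive, hv.isPositiveForm_iff hs hvw, hgv.isPositiveForm_iff hs hgvx]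
  simp only [hg.1]

/-- In dimension at least three the complement of `v` represents every length. In dimension two
everything depends on the line being negative; this is why hyperbolic lines are excluded. -/
theorem exists_elliptic_mem (hs : B.IsSymm) (h2 : (2 : F) ≠ 0) {x : NondegSubspace B}
    (hx : x.dim = 2 → ¬ x.IsPositive) {v : V} (hvx : v ∈ x.carrier) (hv : B v v ≠ 0) :
    x.carrier = Submodule.span F {v} ∨ ∃ u ∈ x.carrier, Elliptic B v u := by
  have hle := (Submodule.span_singleton_le_iff_mem v x.carrier).2 hvx
  have hr : Module.finrank F (Submodule.span F {v}) = 1 :=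
    finrank_span_singleton fun h0 => hv (by simp [h0])
  have hpos : 0 < Module.finrank F x.carrier :=
    Nat.pos_of_ne_zero fun h => x.ne_bot (Submodule.finrank_eq_zero.1 h)
  have hvn := restrict_span_singleton_nondegenerate hs hv
  obtain h1 | h3 | h3 : Module.finrank F x.carrier = 1 ∨ Module.finrank F x.carrier = 2 ∨
    3 ≤ Module.finrank F x.carrier := by omega
  · exact Or.inl (Submodule.eq_of_le_of_finrank_eq hle (hr.trans h1.symm)).symm
  · right
    obtain ⟨u, hux, hvu, huu⟩ := exists_orthogonal_ne_zero hs h2 hvn x.nondegenerate hle (by omega)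
    have hvu' := hvu v (Submodule.mem_span_singleton_self v)
    refine ⟨u, hux, fun hsq => hx h3 ?_⟩
    have hf := isOrthFrame_pair hs hv huu hvu'
    have hspan : Submodule.span F (Set.range ![v, u]) = x.carrier := by
      refine Submodule.eq_of_le_of_finrank_eq ?_ (by rw [hf.finrank_span, h3])
      rw [Submodule.span_le]
      rintro _ ⟨i, rfl⟩
      fin_cases i
      · exact hvx
      · exact hux
    rw [IsPositive, hf.isPositiveForm_iff hs hspan]
    refine iff_of_true ?_ (Or.inl (by decide))
    convert hsq using 1
    rw [lineDiscr, hvu']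
    simp [Fin.prod_univ_succ]
  · right
    obtain ⟨n, hns⟩ := exists_not_isSquare (F := F) h2
    obtain ⟨u, hux, hvu, huu⟩ := exists_orthogonal_eq hs h2 hvn x.nondegenerate hle (by omega)
      (-n / B v v)
    refine ⟨u, hux, ?_⟩
    rw [Elliptic, lineDiscr, hvu v (Submodule.mem_span_singleton_self v), huu]
    convert hns using 2
    field_simp
    ring

theorem exists_mem_orbitSet_point (hs : B.IsSymm) (h2 : (2 : F) ≠ 0)
    (hdim : 1 < Module.finrank F V) {W : Set (NondegSubspace B)} {p p' : NondegSubspace B}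
    (hpW : p ∈ W) (hpW' : p' ∈ W) (hp : p.dim = 1 ∧ p.IsPositive)
    (hp' : p'.dim = 1 ∧ ¬ p'.IsPositive) {v : V} (hv : B v v ≠ 0) :
    ∃ x ∈ orbitSet W, x.carrier = Submodule.span F {v} := by
  have hf := isOrthFrame_singleton hv
  let x := ofFrame hs _ hf one_pos hdim
  have hx : x.dim = 1 := hf.finrank_span
  have hcar : x.carrier = Submodule.span F {v} := by
    change Submodule.span F (Set.range ![v]) = _
    simp
  by_cases h : x.IsPositive
  · exact ⟨x, mem_orbitSet hs h2 hpW (hp.1.trans hx.symm) (iff_of_true hp.2 h), hcar⟩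
  · exact ⟨x, mem_orbitSet hs h2 hpW' (hp'.1.trans hx.symm) (iff_of_false hp'.2 h), hcar⟩

theorem exists_mem_orbitSet_line (hs : B.IsSymm) (h2 : (2 : F) ≠ 0)
    (hdim : 2 < Module.finrank F V) {W : Set (NondegSubspace B)} {l : NondegSubspace B}
    (hlW : l ∈ W) (hl : l.dim = 2 ∧ ¬ l.IsPositive) {a b : V} (hab : Elliptic B a b) :
    ∃ x ∈ orbitSet W, x.carrier = Submodule.span F {a, b} := by
  have ha := hab.left_ne_zero
  obtain ⟨h1, h3⟩ := orthogonal_component hs ha b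
  have hb' : B (b - (B a b / B a a) • a) (b - (B a b / B a a) • a) ≠ 0 := by
    rw [h3]
    exact div_ne_zero (neg_ne_zero.2 hab.lineDiscr_ne_zero) ha
  have hf := isOrthFrame_pair hs ha hb' h1
  let x := ofFrame hs _ hf two_pos hdim
  have hx : x.dim = 2 := hf.finrank_span
  have hcar : x.carrier = Submodule.span F {a, b} := by
    change Submodule.span F (Set.range ![a, _]) = _
    rw [span_pair_eq_sup_span_singleton a b (B a b / B a a), Matrix.range_cons,
      Matrix.range_cons, Matrix.range_empty, Set.union_empty, Submodule.span_union]
  refine ⟨x, mem_orbitSet hs h2 hlW (hl.1.trans hx.symm) (iff_of_false hl.2 fun h => hab ?_), hcar⟩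
  have h4 := ((hf.isPositiveForm_iff hs rfl).1 h).2 (Or.inl (by decide))
  convert h4 using 1
  simp only [Fin.prod_univ_two, Matrix.cons_val_zero, Matrix.cons_val_one, h3]
  field_simp
  ring

/-- Orthogonalising `a` against `o` and `w` against `z` gives a frame whose Gram determinant is the
product of the two line discriminants; in dimension four the sign factor is `1`. -/
theorem exists_mem_orbitSet_solid (hs : B.IsSymm) (h2 : (2 : F) ≠ 0)
    (hdim : 4 < Module.finrank F V) {W : Set (NondegSubspace B)} {U : NondegSubspace B}
    (hUW : U ∈ W) (hU : U.dim = 4 ∧ U.IsPositive) {o a z w : V} (ho : B o o ≠ 0) (hz : B z z ≠ 0)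
    (hoa : lineDiscr B o a ≠ 0) (hzw : lineDiscr B z w ≠ 0)
    (hsq : IsSquare (lineDiscr B o a * lineDiscr B z w)) (hoz : B o z = 0) (haz : B a z = 0)
    (how : B o w = 0) (haw : B a w = 0) :
    ∃ x ∈ orbitSet W, o ∈ x.carrier ∧ a ∈ x.carrier ∧ z ∈ x.carrier ∧ w ∈ x.carrier := by
  obtain ⟨h1, h3⟩ := orthogonal_component hs ho a
  obtain ⟨h4, h5⟩ := orthogonal_component hs hz w
  have ha' : B (a - (B o a / B o o) • o) (a - (B o a / B o o) • o) ≠ 0 := by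
    rw [h3]
    exact div_ne_zero (neg_ne_zero.2 hoa) ho
  have hw' : B (w - (B z w / B z z) • z) (w - (B z w / B z z) • z) ≠ 0 := by
    rw [h5]
    exact div_ne_zero (neg_ne_zero.2 hzw) hz
  have hf := isOrthFrame_quadruple hs ho ha' hz hw' h1 hoz (by simp [how, hoz])
    (by simp [haz, hoz]) (by simp [how, hoz, haz, haw]) h4
  let x := ofFrame hs _ hf (by decide) hdim
  have hx : x.dim = 4 := hf.finrank_span
  have hmem : ∀ i, ![o, a - (B o a / B o o) • o, z, w - (B z w / B z z) • z] i ∈ x.carrier :=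
    fun i => Submodule.subset_span ⟨i, rfl⟩
  have hox : o ∈ x.carrier := hmem 0
  have hzx : z ∈ x.carrier := hmem 2
  have hax := x.carrier.add_mem (hmem 1) (x.carrier.smul_mem (B o a / B o o) hox)
  have hwx := x.carrier.add_mem (hmem 3) (x.carrier.smul_mem (B z w / B z z) hzx)
  refine ⟨x, mem_orbitSet hs h2 hUW (hU.1.trans hx.symm) (iff_of_true hU.2 ?_), hox,
    by simpa using hax, hzx, by simpa using hwx⟩
  refine (hf.isPositiveForm_iff hs rfl).2 (iff_of_true ?_ (Or.inl (by decide)))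
  convert hsq using 1
  rw [Fin.prod_univ_four]
  change (-1) ^ 2 * (B o o * B (a - (B o a / B o o) • o) (a - (B o a / B o o) • o) * B z z *
    B (w - (B z w / B z z) • z) (w - (B z w / B z z) • z)) = _
  rw [h3, h5]
  field_simp

/-- The geometry induced on an orbit of halls is a geometry. -/
theorem isGeometry_restrict_orbitSet (hs : B.IsSymm) (hn : B.Nondegenerate) (h2 : (2 : F) ≠ 0)
    {W : Set (NondegSubspace B)} (hW : (orthPregeometry B hs hn h2).typ '' W = Set.univ) :
    ((orthPregeometry B hs hn h2).restrict (orbitSet W)).IsGeometry := by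
  have : Finite {i : ℕ // 0 < i ∧ i < Module.finrank F V} :=
    Finite.of_injective (fun i => (⟨i.1, i.2.2⟩ : Fin (Module.finrank F V))) fun i j h =>
      Subtype.ext (congrArg Fin.val h)
  refine Pregeometry.isGeometry_of_exists_extension _ fun A hA i hiA => ?_
  obtain ⟨⟨i, hi0, hid⟩, hi⟩ := i
  obtain ⟨w, hwW, hw⟩ : ∃ w ∈ W, (orthPregeometry B hs hn h2).typ w = ⟨i, hi0, hid⟩ := by
    rw [← Set.mem_image, hW]
    exact Set.mem_univ _
  have hwi : w.dim = i := congrArg Subtype.val hw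
  have hne : ∀ a ∈ A, a.1.dim ≠ i := fun a ha h =>
    hiA ⟨a, ha, Subtype.ext (Subtype.ext h)⟩
  have hchain : ∀ a ∈ A, ∀ b ∈ A, a.1.dim ≤ b.1.dim → a.1.carrier ≤ b.1.carrier := by
    intro a ha b hb hab
    rcases hA a ha b hb with h | h
    · exact h
    · exact (Submodule.eq_of_le_of_finrank_le h hab).ge
  obtain ⟨X, hXn, hXi, hXle, hX⟩ : ∃ X : Submodule F V, (B.restrict X).Nondegenerate ∧
      Module.finrank F X < i ∧ (∀ a ∈ A, a.1.dim < i → a.1.carrier ≤ X) ∧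
      (X = ⊥ ∨ ∃ a ∈ A, X = a.1.carrier) := by
    by_cases hex : {a | a ∈ A ∧ a.1.dim < i}.Nonempty
    · obtain ⟨a, ⟨ha, hai⟩, hmin⟩ := WellFounded.has_min
        (measure fun a : orbitSet W => i - a.1.dim).wf _ hex
      refine ⟨a.1.carrier, a.1.nondegenerate, hai, fun b hb hbi => hchain b hb a ha ?_,
        Or.inr ⟨a, ha, rfl⟩⟩
      have : ¬ (i - b.1.dim < i - a.1.dim) := hmin b ⟨hb, hbi⟩
      omega
    · refine ⟨⊥, restrict_bot_nondegenerate hs, by rwa [finrank_bot], fun a ha hai => ?_,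
        Or.inl rfl⟩
      exact absurd ⟨a, ha, hai⟩ hex
  obtain ⟨Y, hYn, hYi, hYge, hXY⟩ : ∃ Y : Submodule F V, (B.restrict Y).Nondegenerate ∧
      i < Module.finrank F Y ∧ (∀ a ∈ A, i < a.1.dim → Y ≤ a.1.carrier) ∧ X ≤ Y := by
    by_cases hex : {a | a ∈ A ∧ i < a.1.dim}.Nonempty
    · obtain ⟨a, ⟨ha, hai⟩, hmin⟩ := WellFounded.has_min
        (measure fun a : orbitSet W => a.1.dim).wf _ hex
      refine ⟨a.1.carrier, a.1.nondegenerate, hai, fun b hb hbi => hchain a ha b hb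
        (not_lt.1 (hmin b ⟨hb, hbi⟩)), ?_⟩
      rcases hX with rfl | ⟨b, hb, rfl⟩
      · exact bot_le
      · exact hchain b hb a ha (hXi.trans hai).le
    · refine ⟨⊤, restrict_top_nondegenerate hs hn, by rwa [finrank_top], fun a ha hai => ?_,
        le_top⟩
      exact absurd ⟨a, ha, hai⟩ hex
  -- The sign of `w` is prescribed so that `Z` is conjugate to `w`.
  obtain ⟨Z, hXZ, hZY, hZn, hZi, hZ⟩ :=
    exists_nondegenerate_between hs h2 hXn hYn hXY hXi hYi w.IsPositive
  let z : NondegSubspace B := ⟨Z, by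
    rintro rfl
    rw [finrank_bot] at hZi
    omega, by
    rintro rfl
    rw [finrank_top] at hZi
    omega, hZn⟩
  have hz : z ∈ orbitSet W := mem_orbitSet hs h2 hwW (hwi.trans hZi.symm) hZ.symm
  refine ⟨⟨z, hz⟩, Subtype.ext (Subtype.ext hZi), fun a ha => ?_⟩
  rcases lt_or_gt_of_ne (hne a ha) with h | h
  · exact Or.inl ((hXle a ha h).trans hXZ)
  · exact Or.inr (hZY.trans (hYge a ha h))

theorem nonempty_ellipticModel (hs : B.IsSymm) (hn : B.Nondegenerate) (h2 : (2 : F) ≠ 0)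
    (hdim : 5 ≤ Module.finrank F V) {W : Set (NondegSubspace B)} {p p' l U : NondegSubspace B}
    (hpW : p ∈ W) (hpW' : p' ∈ W) (hlW : l ∈ W) (hUW : U ∈ W)
    (hp : p.dim = 1 ∧ p.IsPositive) (hp' : p'.dim = 1 ∧ ¬ p'.IsPositive)
    (hl : l.dim = 2 ∧ ¬ l.IsPositive) (hU : U.dim = 4 ∧ U.IsPositive)
    (hlines : ∀ x ∈ W, x.dim = 2 → ¬ x.IsPositive) :
    Nonempty (EllipticModel B ((orthPregeometry B hs hn h2).restrict (orbitSet W))) := by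
  have hpt : ∀ v : V, ∃ x : orbitSet W, B v v ≠ 0 → x.1.carrier = Submodule.span F {v} := by
    intro v
    by_cases hv : B v v ≠ 0
    · obtain ⟨x, hx, hxv⟩ := exists_mem_orbitSet_point hs h2 (by omega) hpW hpW' hp hp' hv
      exact ⟨⟨x, hx⟩, fun _ => hxv⟩
    · exact ⟨⟨p, mem_orbitSet hs h2 hpW rfl Iff.rfl⟩, fun h => absurd h hv⟩
  have hln : ∀ a b : V, ∃ x : orbitSet W, Elliptic B a b →
      x.1.carrier = Submodule.span F {a, b} := by
    intro a b
    by_cases hab : Elliptic B a b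
    · obtain ⟨x, hx, hxab⟩ := exists_mem_orbitSet_line hs h2 (by omega) hlW hl hab
      exact ⟨⟨x, hx⟩, fun _ => hxab⟩
    · exact ⟨⟨p, mem_orbitSet hs h2 hpW rfl Iff.rfl⟩, fun h => absurd h hab⟩
  choose pt hpt using hpt
  choose ln hln using hln
  exact ⟨{
    sub := fun x => x.1.carrier
    sub_injective := fun x y h => Subtype.ext (carrier_injective h)
    inc_iff := fun x y => Iff.rfl
    pt := pt
    sub_pt := hpt
    ln := ln
    sub_ln := hln
    exists_solid := fun o a z w ho hz hoa hzw hsq hoz haz how haw => by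
      obtain ⟨x, hx, h⟩ := exists_mem_orbitSet_solid hs h2 (by omega) hUW hU ho hz hoa hzw hsq hoz
        haz how haw
      exact ⟨⟨x, hx⟩, h⟩
    exists_mem := fun x => exists_mem_ne_zero hs h2 x.1
    exists_elliptic := fun x v hvx hv => exists_elliptic_mem hs h2 (fun hx2 => by
      obtain ⟨w, hw, hwx, hpos⟩ := exists_dim_eq_of_mem_orbitSet hs h2 x.2
      rw [← hpos]
      exact hlines w hw (hwx.trans hx2)) hvx hv }⟩

end NondegSubspace

theorem theorem4p12 {F : Type u} {V : Type v} [Field F] [Fintype F] [AddCommGroup V] [Module F V]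
    [FiniteDimensional F V]
    (hodd : Odd (Fintype.card F)) (hq : 9 ≤ Fintype.card F) (hdim : 5 ≤ Module.finrank F V)
    (B : LinearMap.BilinForm F V) (hsymm : B.IsSymm) (hnd : B.Nondegenerate)
    (hpos : IsPositiveForm B)
    (W : Set (NondegSubspace B))
    (hW : (orthPregeometry B hsymm hnd (two_ne_zero_of_odd_card hodd)).IsHall W)
    (p p' l P U : NondegSubspace B) (S : Set (NondegSubspace B))
    (hWS : W = {p, p', l, P, U} ∪ S)
    (hp : p.dim = 1 ∧ p.IsPositive)
    (hp' : p'.dim = 1 ∧ p'.IsNegative)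
    (hl : l.dim = 2 ∧ l.IsNegative)
    (hP : P.dim = 3)
    (hU : U.dim = 4 ∧ U.IsPositive)
    (hS : ∀ x ∈ S, 3 ≤ x.dim) :
    ((orthPregeometry B hsymm hnd (two_ne_zero_of_odd_card hodd)).restrict
      (NondegSubspace.orbitSet W)).IsSimplyConnected := by
  have h2 := two_ne_zero_of_odd_card hodd
  have hlines : ∀ x ∈ W, x.dim = 2 → ¬ x.IsPositive := by
    intro x hx hx2
    rw [hWS] at hx
    rcases hx with (rfl | rfl | rfl | rfl | rfl) | hx
    · omega
    · omega
    · exact hl.2.2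
    · omega
    · omega
    · have := hS x hx
      omega
  obtain ⟨M⟩ := NondegSubspace.nonempty_ellipticModel hsymm hnd h2 hdim (W := W) (p := p)
    (p' := p') (l := l) (U := U) (by simp [hWS]) (by simp [hWS]) (by simp [hWS]) (by simp [hWS]) hp
    ⟨hp'.1, hp'.2.2⟩ ⟨hl.1, hl.2.2⟩ hU hlines
  exact M.isSimplyConnected
    (NondegSubspace.isGeometry_restrict_orbitSet hsymm hnd h2 hW.2) hsymm hnd h2 hq hdim
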